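/- Let $\mu$ be a $\sigma$-finite positive measure on $X$ and let $M(X,\mu)$ be the space of classes (modulo equality a.e.) of complex measurable functions on $X$. A Banach function space is a complex Banach space $L\subseteq M(X,\mu)$ such that $f\in L$, $g\in M(X,\mu)$, $|g|\le|f|$ imply $g\in L$ and $\|g\|\le\|f\|$, and such that no measurable set $Y$ with $\mu(Y)>0$ satisfies $f=0$ a.e. on $Y$ for all $f\in L$. A kernel operator on $L$ is a linear operator $K$ for which there is a $\mu\times\mu$-measurable $k$ on $X\times X$ with $\int_X|k(x,y)f(y)|\,d\mu(y)<\infty$ and $(Kf)(x)=\int_X k(x,y)f(y)\,d\mu(y)$ for all $f\in L$ and almost all $x$; it is positive if it maps nonnegative functions to nonnegative functions (it is then bounded, and $k\ge0$ a.e.). If $\alpha_1,\dots,\alpha_m>0$, $\sum_j\alpha_j=1$, and $K_1,\dots,K_m$ are positive kernel operators on $L$ with kernels $k_1,\dots,k_m$, then $K_1^{(\alpha_1)}\circ\cdots\circ K_m^{(\alpha_m)}$ denotes the kernel operator on $L$ with kernel $\prod_j k_j(x,y)^{\alpha_j}$. For sets of operators put $$\Psi_1^{(\alpha_1)}\circ\cdots\circ\Psi_m^{(\alpha_m)}=\{A_1^{(\alpha_1)}\circ\cdots\circ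 A_m^{(\alpha_m)}: A_j\in\Psi_j\},$$ $\Psi\Sigma=\{AB:A\in\Psi,B\in\Sigma\}$ and $\Psi+\Sigma=\{A+B:A\in\Psi,B\in\Sigma\}$. For a bounded operator $A$ on $L$ let $\gamma(A)$ be its Hausdorff measure of non-compactness, i.e. the infimum of all $\delta>0$ such that $A(D_L)\subseteq M+\delta D_L$ for some finite $M\subset L$, where $D_L$ is the closed unit ball of $L$; if $L=L^2(X,\mu)$, let $w(A)=\sup\{|\langle Af,f\rangle|:\|f\|_2=1\}$. For $\rho\in\{\|\cdot\|,\gamma,w\}$ put $\rho(\Psi)=\sup_{A\in\Psi}\rho(A)$ (with $\rho(\emptyset)=0$). A norm is order continuous if $0\le f_n\downarrow0$ (a decreasing sequence with infimum $0$) implies $\|f_n\|\to0$; the Banach dual $L^*$ carries its dual order. Let $k,m\ge1$, let $\{\Psi_{ij}\}_{i=1,j=1}^{k,m}$ be bounded sets of positive kernel operators on a Banach function space $L$ and let $\alpha_1,\dots,\alpha_m$ be positive numbers with $\sum_{j=1}^m\alpha_j=1$. Then, for $\rho=\|\cdot\|$, $$\rho\left((\Psi_{11}^{(\alpha_1)}\circ\cdots\circ\Psi_{1m}^{(\alpha_m)})\cdots(\Psi_{k1}^{(\alpha_1)}\circ\cdots\circ\Psi_{km}^{(\alpha_m)})\right)\le\rho\left((\Psi_{11}\cdots\Psi_{k1})^{(\alpha_1)}\circ\cdots\circ(\Psi_{1m}\cdots\Psi_{km})^{(\alpha_m)}\right)\le\rho(\Psi_{11}\cdots\Psi_{k1})^{\alpha_1}\cdots\rho(\Psi_{1m}\cdots\Psi_{km})^{\alpha_m}$$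 and $$\rho\left((\Psi_{11}^{(\alpha_1)}\circ\cdots\circ\Psi_{1m}^{(\alpha_m)})+\cdots+(\Psi_{k1}^{(\alpha_1)}\circ\cdots\circ\Psi_{km}^{(\alpha_m)})\right)\le\rho\left((\Psi_{11}+\cdots+\Psi_{k1})^{(\alpha_1)}\circ\cdots\circ(\Psi_{1m}+\cdots+\Psi_{km})^{(\alpha_m)}\right)\le\rho(\Psi_{11}+\cdots+\Psi_{k1})^{\alpha_1}\cdots\rho(\Psi_{1m}+\cdots+\Psi_{km})^{\alpha_m}.$$ If, in addition, $L$ and $L^*$ have order continuous norms, then both chains of inequalities hold also for $\rho=\gamma$. If, in addition, $L=L^2(X,\mu)$, then both chains of inequalities hold also for $\rho=w$. -/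

import Mathlib

open MeasureTheory Filter Topology
open scoped ENNReal ComplexOrder Pointwise

/-- A complex Banach function space over `(X, μ)`: a Banach space `L` of (classes of) complex
measurable functions, given with its inclusion into the space `X →ₘ[μ] ℂ` of all such classes,
which is an ideal with monotone norm and whose carrier is all of `X`. -/
class BanachFunctionSpace {X : Type*} [MeasurableSpace X] (μ : Measure X) (L : Type*)
    [NormedAddCommGroup L] [NormedSpace ℂ L] [CompleteSpace L] where
  /-- The inclusion of `L` into the space of classes of measurable functions. -/
  incl : L →ₗ[ℂ] (X →ₘ[μ] ℂ)
  incl_injective : Function.Injective incl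
  solid : ∀ (f : L) (g : X →ₘ[μ] ℂ), (∀ᵐ x ∂μ, ‖g x‖ ≤ ‖incl f x‖) →
    ∃ h : L, incl h = g ∧ ‖h‖ ≤ ‖f‖
  carrier : ∀ Y : Set X, MeasurableSet Y →
    (∀ f : L, ∀ᵐ x ∂μ.restrict Y, incl f x = 0) → μ Y = 0

/-- The spaces `L^p(X, μ)`, `1 ≤ p ≤ ∞`, with `μ` σ-finite, are Banach function spaces. -/
noncomputable instance BanachFunctionSpace.instLp {X : Type*} [MeasurableSpace X] (μ : Measure X) [SigmaFinite μ]
    (p : ℝ≥0∞) [Fact (1 ≤ p)] : BanachFunctionSpace μ (Lp ℂ p μ) where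
  incl :=
    { toFun := fun f => (f : X →ₘ[μ] ℂ)
      map_add' := fun _ _ => rfl
      map_smul' := fun _ _ => rfl }
  incl_injective := Subtype.coe_injective
  solid := by
    intro f g hg
    refine ⟨⟨g, Lp.mem_Lp_of_ae_le hg⟩, rfl, ?_⟩
    exact Lp.norm_le_norm_of_ae_le hg
  carrier := by
    intro Y hY h
    have key : ∀ n, μ (Y ∩ spanningSets μ n) = 0 := by
      intro n
      have hm : MeasurableSet (Y ∩ spanningSets μ n) := hY.inter (measurableSet_spanningSets μ n)
      have hfin : μ (Y ∩ spanningSets μ n) ≠ ∞ :=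
        ((measure_mono Set.inter_subset_right).trans_lt (measure_spanningSets_lt_top μ n)).ne
      have h1 := (ae_restrict_iff' hY).1 (h (indicatorConstLp p hm hfin (1 : ℂ)))
      have h2 := indicatorConstLp_coeFn (p := p) (hs := hm) (hμs := hfin) (c := (1 : ℂ))
      have h3 : ∀ᵐ x ∂μ, x ∉ Y ∩ spanningSets μ n := by
        filter_upwards [h1, h2] with x hx1 hx2 hx
        have h0 := hx1 hx.1
        change (indicatorConstLp p hm hfin (1 : ℂ)) x = 0 at h0
        rw [hx2, Set.indicator_of_mem hx] at h0
        exact one_ne_zero h0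
      simpa [ae_iff] using h3
    have hU : Y = ⋃ n, Y ∩ spanningSets μ n := by
      rw [← Set.inter_iUnion, iUnion_spanningSets, Set.inter_univ]
    rw [hU]
    exact measure_iUnion_null key

section Operators

variable {X : Type*} [MeasurableSpace X] (μ : Measure X) {L : Type*}
  [NormedAddCommGroup L] [NormedSpace ℂ L] [CompleteSpace L] [BanachFunctionSpace μ L]

/-- The element `f` of `L` is nonnegative almost everywhere. -/
def IsNonnegFun (f : L) : Prop := 0 ≤ BanachFunctionSpace.incl (μ := μ) f

/-- The operator `T` is positive: it maps nonnegative functions to nonnegative functions.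
Linear operators on `L` that are positive are automatically bounded, so nothing is lost by
considering elements of `L →L[ℂ] L` only. -/
def IsPositiveOperator (T : L →L[ℂ] L) : Prop :=
  ∀ f : L, IsNonnegFun μ f → IsNonnegFun μ (T f)

/-- `κ` is a kernel of the operator `T`. -/
def HasKernel (T : L →L[ℂ] L) (κ : X → X → ℂ) : Prop :=
  AEStronglyMeasurable (Function.uncurry κ) (μ.prod μ) ∧
    ∀ f : L, ∀ᵐ x ∂μ,
      Integrable (fun y => κ x y * BanachFunctionSpace.incl (μ := μ) f y) μ ∧
      BanachFunctionSpace.incl (μ := μ) (T f) x =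
        ∫ y, κ x y * BanachFunctionSpace.incl (μ := μ) f y ∂μ

/-- `T` is a positive kernel operator on `L`. -/
def IsPositiveKernelOperator (T : L →L[ℂ] L) : Prop :=
  IsPositiveOperator μ T ∧ ∃ κ : X → X → ℂ, HasKernel μ T κ

/-- `T` is the weighted Hadamard geometric mean `A₁^(α₁) ∘ ⋯ ∘ Aₘ^(αₘ)` of the positive kernel
operators `A₁, …, Aₘ`: the operator whose kernel is `∏ⱼ aⱼ(x,y)^αⱼ`, where `aⱼ ≥ 0` (a.e.) is the
kernel of `Aⱼ`. -/
def IsHadamardMean {m : ℕ} (α : Fin m → ℝ) (A : Fin m → L →L[ℂ] L) (T : L →L[ℂ] L) : Prop :=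
  ∃ a : Fin m → X → X → ℝ,
    (∀ j, ∀ᵐ p ∂(μ.prod μ), 0 ≤ a j p.1 p.2) ∧
    (∀ j, HasKernel μ (A j) (fun x y => (a j x y : ℂ))) ∧
    HasKernel μ T (fun x y => ((∏ j, a j x y ^ α j : ℝ) : ℂ))

/-- The weighted Hadamard geometric mean `Ψ₁^(α₁) ∘ ⋯ ∘ Ψₘ^(αₘ)` of sets of operators. -/
def hadamardMeanSet {m : ℕ} (α : Fin m → ℝ) (Ψ : Fin m → Set (L →L[ℂ] L)) :
    Set (L →L[ℂ] L) :=
  {T | ∃ A : Fin m → L →L[ℂ] L, (∀ j, A j ∈ Ψ j) ∧ IsHadamardMean μ α A T}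

variable {μ} in
/-- The weighted Hadamard geometric mean is an operator on the whole of `L`. -/
theorem exists_isHadamardMean [SigmaFinite μ] {m : ℕ} (α : Fin m → ℝ) (hα : ∀ j, 0 ≤ α j)
    (hsum : ∑ j, α j = 1) (A : Fin m → L →L[ℂ] L) (a : Fin m → X → X → ℝ)
    (ha : ∀ j, ∀ᵐ p ∂(μ.prod μ), 0 ≤ a j p.1 p.2)
    (hA : ∀ j, HasKernel μ (A j) (fun x y => (a j x y : ℂ))) :
    ∃ T : L →L[ℂ] L, IsHadamardMean μ α A T := by
  let ι : L →ₗ[ℂ] (X →ₘ[μ] ℂ) := BanachFunctionSpace.incl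
  let κ : X → X → ℂ := fun x y => ((∏ j, a j x y ^ α j : ℝ) : ℂ)
  have hκm : AEStronglyMeasurable (Function.uncurry κ) (μ.prod μ) := by
    have h1 : ∀ j, AEMeasurable (fun p : X × X => a j p.1 p.2) (μ.prod μ) := fun j => by
      have := Complex.measurable_re.comp_aemeasurable (hA j).1.aemeasurable
      exact this
    have h2 : AEMeasurable (fun p : X × X => ∏ j, a j p.1 p.2 ^ α j) (μ.prod μ) :=
      Finset.aemeasurable_fun_prod _ fun j _ => (h1 j).pow_const _
    exact (Complex.measurable_ofReal.comp_aemeasurable h2).aestronglyMeasurable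
  have habs : ∀ f : L, ∃ g : L, (∀ᵐ y ∂μ, ι g y = (‖ι f y‖ : ℂ)) ∧ ‖g‖ ≤ ‖f‖ := by
    intro f
    have hm : AEStronglyMeasurable (fun y => (‖ι f y‖ : ℂ)) μ :=
      Complex.continuous_ofReal.comp_aestronglyMeasurable
        (AEEqFun.aestronglyMeasurable (ι f)).norm
    have hc := AEEqFun.coeFn_mk _ hm
    obtain ⟨g, hg, hgn⟩ := BanachFunctionSpace.solid (μ := μ) f (AEEqFun.mk _ hm) (by
      filter_upwards [hc] with x hx
      rw [hx]; simp [ι])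
    refine ⟨g, ?_, hgn⟩
    change ∀ᵐ y ∂μ, BanachFunctionSpace.incl (μ := μ) g y = _
    rw [hg]; exact hc
  have hmain : ∀ f : L, ∃ h : L,
      (∀ᵐ x ∂μ, Integrable (fun y => κ x y * ι f y) μ ∧
        ι h x = ∫ y, κ x y * ι f y ∂μ) ∧ ‖h‖ ≤ (∑ j, α j * ‖A j‖) * ‖f‖ := by
    intro f
    obtain ⟨g, hg, hgn⟩ := habs f
    have hF : AEStronglyMeasurable (fun p : X × X => κ p.1 p.2 * ι f p.2) (μ.prod μ) :=
      hκm.mul (AEEqFun.aestronglyMeasurable (ι f)).comp_snd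
    have hFx := hF.prodMk_left
    have hG := hF.integral_prod_right'
    have hk : ∀ᵐ x ∂μ, ∀ j, Integrable (fun y => (a j x y : ℂ) * ι g y) μ ∧
        ι (A j g) x = ∫ y, (a j x y : ℂ) * ι g y ∂μ := ae_all_iff.2 fun j => (hA j).2 g
    have hpos : ∀ᵐ x ∂μ, ∀ᵐ y ∂μ, ∀ j, 0 ≤ a j x y :=
      Measure.ae_ae_of_ae_prod (ae_all_iff.2 ha)
    let s : L := ∑ j, (α j : ℂ) • A j g
    have hs : ∀ᵐ x ∂μ, ι s x = ∑ j, (α j : ℂ) * ι (A j g) x := by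
      have e1 : ι s = ∑ j, (α j : ℂ) • ι (A j g) := by
        simp only [s, map_sum, map_smul]
      rw [e1]
      have e2 := AEEqFun.coeFn_finsetSum (μ := μ) Finset.univ
        (fun j => (α j : ℂ) • ι (A j g))
      have e3 : ∀ᵐ x ∂μ, ∀ j, ((α j : ℂ) • ι (A j g) : X →ₘ[μ] ℂ) x
          = (α j : ℂ) * ι (A j g) x := ae_all_iff.2 fun j => by
        filter_upwards [AEEqFun.coeFn_smul (α j : ℂ) (ι (A j g))] with x hx
        rw [hx]; simp
      filter_upwards [e2, e3] with x h2 h3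
      rw [h2]
      simp [h3]
    have hint : ∀ᵐ x ∂μ, Integrable (fun y => κ x y * ι f y) μ ∧
        ‖∫ y, κ x y * ι f y ∂μ‖ ≤ ‖ι s x‖ := by
      filter_upwards [hFx, hk, hpos, hs] with x h1 h2 h3 h4
      have hb : ∀ᵐ y ∂μ, ‖κ x y * ι f y‖ ≤ ∑ j, α j * (a j x y * ‖ι f y‖) := by
        filter_upwards [h3] with y hy
        have := Real.geom_mean_le_arith_mean_weighted Finset.univ α (fun j => a j x y)
          (fun j _ => hα j) hsum (fun j _ => hy j)
        rw [norm_mul]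
        have e : ‖κ x y‖ = ∏ j, a j x y ^ α j := by
          simp only [κ]
          rw [Complex.norm_real, Real.norm_of_nonneg
            (Finset.prod_nonneg fun j _ => Real.rpow_nonneg (hy j) _)]
        rw [e]
        calc _ ≤ (∑ j, α j * a j x y) * ‖ι f y‖ := by gcongr
          _ = _ := by rw [Finset.sum_mul]; simp [mul_assoc]
      have e : ∀ j, (fun y => (a j x y : ℂ) * ι g y) =ᵐ[μ]
          fun y => ((a j x y * ‖ι f y‖ : ℝ) : ℂ) := fun j => by
        filter_upwards [hg] with y hy
        rw [hy]; push_cast; rfl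
      have hi : ∀ j, Integrable (fun y => a j x y * ‖ι f y‖) μ := fun j => by
        have := ((h2 j).1.congr (e j)).re
        simpa using this
      have hI : Integrable (fun y => ∑ j, α j * (a j x y * ‖ι f y‖)) μ :=
        integrable_finsetSum _ fun j _ => (hi j).const_mul _
      refine ⟨hI.mono' h1 hb, ?_⟩
      refine (norm_integral_le_of_norm_le hI hb).trans ?_
      rw [integral_finsetSum _ fun j _ => (hi j).const_mul _, h4]
      have e5 : ∀ j, ι (A j g) x = ((∫ y, a j x y * ‖ι f y‖ ∂μ : ℝ) : ℂ) := fun j => by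
        rw [(h2 j).2, integral_congr_ae (e j), integral_complex_ofReal]
      simp only [e5, integral_const_mul]
      refine le_trans (le_abs_self _) ?_
      rw [← Real.norm_eq_abs, ← Complex.norm_real]
      push_cast
      exact le_rfl
    obtain ⟨h, hh, hhn⟩ := BanachFunctionSpace.solid (μ := μ) s (AEEqFun.mk _ hG) (by
      filter_upwards [AEEqFun.coeFn_mk _ hG, hint] with x hx hx2
      rw [hx]; exact hx2.2)
    refine ⟨h, ?_, hhn.trans ?_⟩
    · have hc := AEEqFun.coeFn_mk _ hG
      rw [← hh] at hc
      filter_upwards [hc, hint] with x hx hx2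
      exact ⟨hx2.1, hx⟩
    · refine (norm_sum_le _ _).trans ?_
      rw [Finset.sum_mul]
      refine Finset.sum_le_sum fun j _ => ?_
      rw [norm_smul, Complex.norm_real, Real.norm_of_nonneg (hα j), mul_assoc]
      exact mul_le_mul_of_nonneg_left (((A j).le_opNorm g).trans (by gcongr)) (hα j)
  choose T hT hTn using hmain
  have hinj : ∀ u v : L, (∀ᵐ x ∂μ, ι u x = ι v x) → u = v := fun u v h =>
    BanachFunctionSpace.incl_injective (μ := μ) (AEEqFun.ext h)
  let T' : L →ₗ[ℂ] L :=
    { toFun := T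
      map_add' := fun u v => by
        apply hinj
        rw [map_add]
        have e1 := AEEqFun.coeFn_add (ι u) (ι v)
        have e2 := AEEqFun.coeFn_add (ι (T u)) (ι (T v))
        have e3 := hT (u + v)
        rw [map_add] at e3
        filter_upwards [e2, e3, hT u, hT v] with x h2 h3 h4 h5
        rw [h2, h3.2, Pi.add_apply, h4.2, h5.2, ← integral_add h4.1 h5.1]
        refine integral_congr_ae ?_
        filter_upwards [e1] with y hy
        rw [hy, Pi.add_apply, mul_add]
      map_smul' := fun c u => by
        apply hinj
        rw [RingHom.id_apply, map_smul]
        have e1 := AEEqFun.coeFn_smul c (ι u)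
        have e2 := AEEqFun.coeFn_smul c (ι (T u))
        have e3 := hT (c • u)
        rw [map_smul] at e3
        filter_upwards [e2, e3, hT u] with x h2 h3 h4
        rw [h2, h3.2, Pi.smul_apply, h4.2, smul_eq_mul, ← integral_const_mul]
        refine integral_congr_ae ?_
        filter_upwards [e1] with y hy
        rw [hy, Pi.smul_apply, smul_eq_mul]; ring }
  exact ⟨T'.mkContinuous _ hTn, a, ha, hA, hκm, hT⟩

variable (L) in
/-- The norm of `L` is order continuous: `0 ≤ fₙ ↓ 0` implies `‖fₙ‖ → 0`. -/
def HasOrderContinuousNorm : Prop :=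
  ∀ f : ℕ → L, Antitone (fun n => BanachFunctionSpace.incl (μ := μ) (f n)) →
    IsGLB (Set.range fun n => BanachFunctionSpace.incl (μ := μ) (f n)) 0 →
    Tendsto (fun n => ‖f n‖) atTop (𝓝 0)

/-- The order `φ ≤ ψ` of the Banach dual `L*`: `ψ - φ` is nonnegative on nonnegative functions. -/
def DualLE (φ ψ : StrongDual ℂ L) : Prop :=
  ∀ f : L, IsNonnegFun μ f → 0 ≤ (ψ - φ) f

variable (L) in
/-- The norm of the Banach dual `L*` is order continuous: `0 ≤ φₙ ↓ 0` implies `‖φₙ‖ → 0`, where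
`φₙ ↓ 0` means that the sequence is decreasing with greatest lower bound `0` in the order
of `L*`. -/
def DualHasOrderContinuousNorm : Prop :=
  ∀ φ : ℕ → StrongDual ℂ L, (∀ n l, n ≤ l → DualLE μ (φ l) (φ n)) →
    (∀ n, DualLE μ 0 (φ n)) →
    (∀ ψ : StrongDual ℂ L, (∀ n, DualLE μ ψ (φ n)) → DualLE μ ψ 0) →
    Tendsto (fun n => ‖φ n‖) atTop (𝓝 0)

end Operators

/-- The Hausdorff measure of non-compactness of a bounded operator. -/
noncomputable def hausdorffMNC {L : Type*} [NormedAddCommGroup L] [NormedSpace ℂ L]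
    (T : L →L[ℂ] L) : ℝ :=
  sInf {δ : ℝ | 0 < δ ∧ ∃ M : Set L, M.Finite ∧
    T '' Metric.closedBall 0 1 ⊆ M + δ • Metric.closedBall (0 : L) 1}

/-- The numerical radius of a bounded operator on a Hilbert space (for a space `{0}` it is `0`). -/
noncomputable def numericalRadius {H : Type*} [NormedAddCommGroup H] [InnerProductSpace ℂ H]
    (T : H →L[ℂ] H) : ℝ :=
  sSup {r : ℝ | ∃ f : H, ‖f‖ = 1 ∧ r = ‖inner ℂ f (T f)‖}

/-- `ρ(Ψ) = sup_{A ∈ Ψ} ρ(A)` for a nonnegative quantity `ρ`; the supremum is taken in `[0, ∞]`,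
so that it is never a default value, and `ρ(∅) = 0`. -/
noncomputable def supOver {E : Type*} (ρ : E → ℝ) (Ψ : Set E) : ℝ≥0∞ :=
  ⨆ A ∈ Ψ, ENNReal.ofReal (ρ A)

section Inequalities

variable {X : Type*} [MeasurableSpace X] (μ : Measure X) {L : Type*}
  [NormedAddCommGroup L] [NormedSpace ℂ L] [CompleteSpace L] [BanachFunctionSpace μ L]

/-- The two inequalities for products, for the quantity `ρ`. Products of sets of operators are
`ΨΣ = {AB : A ∈ Ψ, B ∈ Σ}`. -/
def ProductInequalities {k m : ℕ} (α : Fin m → ℝ) (Ψ : Fin k → Fin m → Set (L →L[ℂ] L))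
    (ρ : (L →L[ℂ] L) → ℝ) : Prop :=
  supOver ρ (List.ofFn fun i => hadamardMeanSet μ α (Ψ i)).prod
      ≤ supOver ρ (hadamardMeanSet μ α fun j => (List.ofFn fun i => Ψ i j).prod) ∧
  supOver ρ (hadamardMeanSet μ α fun j => (List.ofFn fun i => Ψ i j).prod)
      ≤ ∏ j, supOver ρ (List.ofFn fun i => Ψ i j).prod ^ α j

/-- The two inequalities for sums, for the quantity `ρ`. Sums of sets of operators are
`Ψ + Σ = {A + B : A ∈ Ψ, B ∈ Σ}`. -/
def SumInequalities {k m : ℕ} (α : Fin m → ℝ) (Ψ : Fin k → Fin m → Set (L →L[ℂ] L))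
    (ρ : (L →L[ℂ] L) → ℝ) : Prop :=
  supOver ρ (∑ i, hadamardMeanSet μ α (Ψ i))
      ≤ supOver ρ (hadamardMeanSet μ α fun j => ∑ i, Ψ i j) ∧
  supOver ρ (hadamardMeanSet μ α fun j => ∑ i, Ψ i j)
      ≤ ∏ j, supOver ρ (∑ i, Ψ i j) ^ α j

end Inequalities

/-!
Call a quantity `ρ` for operators on `L` a *monotone seminorm* if it is nonnegative, subadditive,
positively homogeneous, and if `ρ T ≤ ρ S` whenever `T` and `S` have kernels `0 ≤ t ≤ s`. Both chains
of inequalities hold for every monotone seminorm.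

* First inequality. By Hölder's inequality, for integrals in the case of products and for finite sums
  in the case of sums, an operator `T` in the left-hand set has a kernel that is at most the weighted
  geometric mean of kernels of operators `A j` in the sets on the right (`MeanDominated.mul`,
  `MeanDominated.sum`). That mean is again the kernel of an operator
  (`MeanDominated.exists_isHadamardMean`), and `ρ` is monotone. Compositions of kernels are finite
  almost everywhere because `L` has a strictly positive element (`exists_val_pos`).
* Second inequality. For weights `c j > 0` with `∏ c j ^ α j = 1`, the geometric mean of the kernels
  of the `A j` equals that of the kernels of the `c j • A j`, and so is at most the kernel of
  `∑ α j c j • A j`. Hence `ρ T ≤ ∑ α j c j ρ (A j)`, and the best choice of the weights turns the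
  right-hand side into `∏ ρ (A j) ^ α j` (`IsMonotoneSeminorm.le_prod_rpow`).

The operator norm and the numerical radius are monotone seminorms because `|T f| ≤ S |f|`. For the
Hausdorff measure of non-compactness, monotonicity is the essential point
(`KernelLE.hausdorffMNC_le`): if `S` maps the unit ball into a `δ`-neighbourhood of a finite set `M`
and `u = ∑_{m ∈ M} |m|`, then `|T f| ≤ u + g` with `‖g‖ ≤ δ`, so that up to an error of norm `δ` one may
truncate `T f` at `u`. The truncations form a totally bounded set
(`IsNNKernel.totallyBounded_trunc`), for the following reasons.

* Order continuity of the norm of `L` gives a strictly positive density `w` with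
  `∫ w |f| ≤ ‖f‖` (`HasOrderContinuousNorm.exists_pos_density`), by separating points of `L ∩ L²` from
  the unit ball in `L²`, followed by an exhaustion argument.
* Order continuity of the dual norm makes every positive kernel operator compact from `L` to `L¹(w μ)`
  (`HasL1Bound.hasCompactL1Operator`): kernels of rank one are compact, and increasing limits of
  kernels give norm limits of operators, so that a monotone class argument applies.
* Hence each sequence `T fₙ` with `‖fₙ‖ ≤ 1` has a subsequence that converges almost everywhere, and by
  order continuity its truncations at `u` converge in norm.
-/

open scoped NNReal

/-! ### Pointwise calculus in a Banach function space -/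

section Values

variable {X : Type*} [MeasurableSpace X] (μ : Measure X) {L : Type*}
  [NormedAddCommGroup L] [NormedSpace ℂ L] [CompleteSpace L] [BanachFunctionSpace μ L]

/-- A representative `X → ℂ` of the element `f` of a Banach function space. -/
noncomputable def val (f : L) : X → ℂ := BanachFunctionSpace.incl (μ := μ) f

theorem aestronglyMeasurable_val (f : L) : AEStronglyMeasurable (val μ f) μ :=
  AEEqFun.aestronglyMeasurable _

theorem ext_of_val_ae_eq {f g : L} (h : val μ f =ᵐ[μ] val μ g) : f = g :=
  BanachFunctionSpace.incl_injective (μ := μ) (AEEqFun.ext h)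

theorem val_add (f g : L) : val μ (f + g) =ᵐ[μ] fun x => val μ f x + val μ g x := by
  unfold val
  rw [map_add]
  exact AEEqFun.coeFn_add _ _

theorem val_sub (f g : L) : val μ (f - g) =ᵐ[μ] fun x => val μ f x - val μ g x := by
  unfold val
  rw [map_sub]
  exact AEEqFun.coeFn_sub _ _

theorem val_smul (c : ℂ) (f : L) : val μ (c • f) =ᵐ[μ] fun x => c * val μ f x := by
  unfold val
  rw [map_smul]
  exact AEEqFun.coeFn_smul _ _

variable (L) in
theorem val_zero : val μ (0 : L) =ᵐ[μ] fun _ => 0 := by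
  unfold val
  rw [map_zero]
  exact AEEqFun.coeFn_zero

theorem val_sum {ι : Type*} (s : Finset ι) (f : ι → L) :
    val μ (∑ i ∈ s, f i) =ᵐ[μ] fun x => ∑ i ∈ s, val μ (f i) x := by
  classical
  induction s using Finset.induction with
  | empty => simpa using val_zero μ L
  | insert i s hi ih =>
    rw [Finset.sum_insert hi]
    filter_upwards [val_add μ (f i) (∑ i ∈ s, f i), ih] with x h1 h2
    rw [h1, h2, Finset.sum_insert hi]

theorem exists_val_ae_eq (f : L) {g : X → ℂ} (hg : AEStronglyMeasurable g μ)
    (h : ∀ᵐ x ∂μ, ‖g x‖ ≤ ‖val μ f x‖) : ∃ h : L, val μ h =ᵐ[μ] g := by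
  obtain ⟨h, hh, -⟩ := BanachFunctionSpace.solid (μ := μ) f (AEEqFun.mk g hg) (by
    filter_upwards [AEEqFun.coeFn_mk g hg, h] with x h1 h2
    rw [h1]; exact h2)
  refine ⟨h, ?_⟩
  unfold val
  rw [hh]
  exact AEEqFun.coeFn_mk g hg

theorem norm_le_of_val_ae_le {f g : L} (h : ∀ᵐ x ∂μ, ‖val μ f x‖ ≤ ‖val μ g x‖) :
    ‖f‖ ≤ ‖g‖ := by
  obtain ⟨f', hf', hn⟩ := BanachFunctionSpace.solid (μ := μ) g
    (BanachFunctionSpace.incl (μ := μ) f) h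
  rwa [BanachFunctionSpace.incl_injective hf'] at hn

theorem exists_modulus (f : L) : ∃ g : L, val μ g =ᵐ[μ] fun x => (‖val μ f x‖ : ℂ) :=
  exists_val_ae_eq μ f
    (Complex.continuous_ofReal.comp_aestronglyMeasurable (aestronglyMeasurable_val μ f).norm)
    (by simp)

/-- The modulus `|f|` of an element of a Banach function space. -/
noncomputable def modulus (f : L) : L := (exists_modulus μ f).choose

theorem val_modulus (f : L) : val μ (modulus μ f) =ᵐ[μ] fun x => (‖val μ f x‖ : ℂ) :=
  (exists_modulus μ f).choose_spec

theorem norm_modulus (f : L) : ‖modulus μ f‖ = ‖f‖ := by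
  apply le_antisymm <;> apply norm_le_of_val_ae_le μ <;>
    filter_upwards [val_modulus μ f] with x hx <;> simp [hx]

/-- The positive cone is closed under norm limits. -/
theorem val_nonneg_of_tendsto {f : ℕ → L} {g : L} (hf : Tendsto f atTop (𝓝 g))
    (h : ∀ᶠ n in atTop, ∀ᵐ x ∂μ, 0 ≤ val μ (f n) x) : ∀ᵐ x ∂μ, 0 ≤ val μ g x := by
  -- the distance of `z` to `[0, ∞) ⊆ ℂ` is at least half of `‖z - ‖z‖‖`
  have key : ∀ z w : ℂ, 0 ≤ w → ‖z - ‖z‖‖ ≤ 2 * ‖z - w‖ := by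
    intro z w hw
    have e : (w : ℂ) = (‖w‖ : ℂ) := (Complex.eq_coe_norm_of_nonneg hw)
    have h1 : ‖w - (‖z‖ : ℂ)‖ ≤ ‖z - w‖ := by
      rw [e, ← Complex.ofReal_sub, Complex.norm_real, ← e, norm_sub_rev z w]
      simpa using abs_norm_sub_norm_le w z
    calc ‖z - ‖z‖‖ = ‖(z - w) + (w - ‖z‖)‖ := by ring_nf
      _ ≤ ‖z - w‖ + ‖w - ‖z‖‖ := norm_add_le _ _
      _ ≤ _ := by linarith
  have h0 : g - modulus μ g = 0 := by
    have hlim : Tendsto (fun n => 2 * ‖g - f n‖) atTop (𝓝 (2 * ‖g - g‖)) :=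
      ((tendsto_const_nhds.sub hf).norm).const_mul 2
    have hle : ∀ᶠ n in atTop, ‖g - modulus μ g‖ ≤ 2 * ‖g - f n‖ := by
      filter_upwards [h] with n hn
      have e : (2 : ℝ) * ‖g - f n‖ = ‖(2 : ℂ) • (g - f n)‖ := by simp [norm_smul]
      rw [e]
      apply norm_le_of_val_ae_le μ
      filter_upwards [val_sub μ g (modulus μ g), val_modulus μ g, val_smul μ 2 (g - f n),
        val_sub μ g (f n), hn] with x h1 h2 h3 h4 h5
      rw [h1, h2, h3, h4, norm_mul]
      simpa using key _ _ h5
    have := ge_of_tendsto hlim hle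
    simpa using this
  have h1 : g = modulus μ g := sub_eq_zero.1 h0
  have h2 := val_modulus μ g
  rw [← h1] at h2
  filter_upwards [h2] with x hx
  rw [hx]
  exact_mod_cast norm_nonneg _

end Values

/-! ### A strictly positive element -/

/-- Exhaustion: a family of measurable functions that is closed under the weighted countable sums
`∑ 2⁻ⁿ⁻¹ wₙ` has a member whose support contains, up to null sets, the support of every member. -/
theorem exists_maximal_support {X : Type*} [MeasurableSpace X] (μ : Measure X) [SigmaFinite μ]
    (W : Set (X → ℝ≥0∞)) (hW : ∀ w ∈ W, Measurable w) (hne : W.Nonempty)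
    (hsum : ∀ w : ℕ → X → ℝ≥0∞, (∀ n, w n ∈ W) →
      (fun x => ∑' n, 2⁻¹ ^ (n + 1) * w n x) ∈ W) :
    ∃ w ∈ W, ∀ w' ∈ W, ∀ᵐ x ∂μ, w x = 0 → w' x = 0 := by
  let m : Measure X := μ.toFinite
  have hm : ∀ s, m s ≠ ∞ := fun s => measure_ne_top _ _
  let S : Set ℝ≥0∞ := (fun w => m (Function.support w)) '' W
  obtain ⟨u, -, hu, huS⟩ := exists_seq_tendsto_sSup (S := S) (hne.image _) (OrderTop.bddAbove _)
  choose w hwW hw using huS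
  have hsupp : ∀ v : ℕ → X → ℝ≥0∞, ∀ n,
      Function.support (v n) ⊆ Function.support fun x => ∑' n, 2⁻¹ ^ (n + 1) * v n x := by
    intro v n x hx h0
    have := ENNReal.tsum_eq_zero.1 h0 n
    rcases mul_eq_zero.1 this with h | h
    · exact (pow_ne_zero _ (by simp)) h
    · exact hx h
  refine ⟨_, hsum w hwW, fun w' hw' => ?_⟩
  set w₀ : X → ℝ≥0∞ := fun x => ∑' n, 2⁻¹ ^ (n + 1) * w n x with hw₀
  have hle : sSup S ≤ m (Function.support w₀) := by
    refine le_of_tendsto' hu fun n => ?_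
    rw [← hw n]
    exact measure_mono (hsupp w n)
  let v : ℕ → X → ℝ≥0∞ := fun n => if n = 0 then w₀ else w'
  have hv : ∀ n, v n ∈ W := fun n => by
    by_cases h : n = 0
    · simpa [v, h] using hsum w hwW
    · simpa [v, h] using hw'
  have h0 : Function.support w₀ ⊆ _ := hsupp v 0
  have h1 : Function.support w' ⊆ _ := hsupp v 1
  have h2 : m (Function.support w₀ ∪ Function.support w') ≤ m (Function.support w₀) :=
    (measure_mono (Set.union_subset h0 h1)).trans
      ((le_sSup ⟨_, hsum v hv, rfl⟩ : _ ≤ sSup S).trans hle)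
  have h3 : m (Function.support w' \ Function.support w₀) = 0 := by
    have hms : MeasurableSet (Function.support w₀) :=
      measurableSet_support (hW _ (hsum w hwW))
    have h4 := measure_sdiff (μ := m) (s₁ := Function.support w₀ ∪ Function.support w')
      Set.subset_union_left hms.nullMeasurableSet (hm _)
    rw [Set.union_sdiff_left] at h4
    rw [h4, tsub_eq_zero_of_le h2]
  have h5 : ∀ᵐ x ∂m, w₀ x = 0 → w' x = 0 := by
    rw [ae_iff]
    refine measure_mono_null (fun x hx => ?_) h3
    simp only [Set.mem_ofPred_eq, Classical.not_imp] at hx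
    exact ⟨hx.2, fun h => h hx.1⟩
  rwa [ae_toFinite] at h5

/-- A Banach function space over a σ-finite measure contains a function that is positive
almost everywhere. -/
theorem exists_val_pos {X : Type*} [MeasurableSpace X] (μ : Measure X) [SigmaFinite μ] (L : Type*)
    [NormedAddCommGroup L] [NormedSpace ℂ L] [CompleteSpace L] [BanachFunctionSpace μ L] :
    ∃ e : L, ∀ᵐ x ∂μ, 0 < val μ e x := by
  let W : Set (X → ℝ≥0∞) := {w | Measurable w ∧ ∃ f : L, ‖f‖ ≤ 1 ∧
    ∀ᵐ x ∂μ, w x ≤ ENNReal.ofReal ‖val μ f x‖}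
  obtain ⟨w, ⟨hwm, f, -, hf⟩, hmax⟩ := exists_maximal_support μ W (fun w hw => hw.1)
    ⟨fun _ => 0, measurable_const, 0, by simp, by simp⟩ (by
      intro w hw
      choose hwm f hf1 hwf using hw
      refine ⟨?_, ?_⟩
      · exact Measurable.tsum fun n => (hwm n).const_mul _
      let a : ℕ → L := fun n => ((2⁻¹ ^ (n + 1) : ℝ) : ℂ) • modulus μ (f n)
      have hgeo : HasSum (fun n : ℕ => (2⁻¹ : ℝ) ^ (n + 1)) 1 := by
        have := (hasSum_geometric_of_lt_one (r := (2⁻¹ : ℝ)) (by norm_num) (by norm_num)).mul_left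
          2⁻¹
        have h2 : (2⁻¹ : ℝ) * (1 - 2⁻¹)⁻¹ = 1 := by norm_num
        rw [h2] at this
        simpa only [pow_succ'] using this
      have han : ∀ n, ‖a n‖ ≤ 2⁻¹ ^ (n + 1) := by
        intro n
        rw [norm_smul, norm_modulus, Complex.norm_real, Real.norm_of_nonneg (by positivity)]
        exact mul_le_of_le_one_right (by positivity) (hf1 n)
      have has : Summable a := Summable.of_norm_bounded hgeo.summable han
      have hpos : ∀ n, ∀ᵐ x ∂μ, val μ (a n) x = ((2⁻¹ ^ (n + 1) * ‖val μ (f n) x‖ : ℝ) : ℂ) := by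
        intro n
        filter_upwards [val_smul μ ((2⁻¹ ^ (n + 1) : ℝ) : ℂ) (modulus μ (f n)),
          val_modulus μ (f n)] with x h1 h2
        rw [h1, h2]; push_cast; rfl
      refine ⟨∑' n, a n, ?_, ?_⟩
      · exact (tsum_of_norm_bounded hgeo han)
      have hpart : ∀ N, ∀ᵐ x ∂μ, ∑ n ∈ Finset.range N, 2⁻¹ ^ (n + 1) * ‖val μ (f n) x‖ ≤
          ‖val μ (∑' n, a n) x‖ := by
        intro N
        have h1 : Tendsto (fun K => ∑ n ∈ Finset.range K, a n - ∑ n ∈ Finset.range N, a n) atTop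
            (𝓝 (∑' n, a n - ∑ n ∈ Finset.range N, a n)) :=
          has.hasSum.tendsto_sum_nat.sub_const _
        have h2 := val_nonneg_of_tendsto μ h1 (by
          filter_upwards [eventually_ge_atTop N] with K hK
          rw [← Finset.sum_Ico_eq_sub _ hK]
          filter_upwards [val_sum μ (Finset.Ico N K) a, ae_all_iff.2 hpos] with x h3 h4
          rw [h3]
          refine Finset.sum_nonneg fun n _ => ?_
          rw [h4]
          exact_mod_cast by positivity)
        filter_upwards [h2, val_sub μ (∑' n, a n) (∑ n ∈ Finset.range N, a n),
          val_sum μ (Finset.range N) a, ae_all_iff.2 hpos] with x h3 h4 h5 h6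
        rw [h4, h5] at h3
        simp only [h6] at h3
        have h7 := (Complex.le_def.1 h3).1
        have h8 := Complex.re_le_norm (val μ (∑' n, a n) x)
        rw [← Complex.ofReal_sum] at h7
        simp only [Complex.zero_re, Complex.sub_re, Complex.ofReal_re] at h7
        linarith
      filter_upwards [ae_all_iff.2 hpart, ae_all_iff.2 hwf] with x h1 h2
      rw [ENNReal.tsum_eq_iSup_nat]
      refine iSup_le fun N => ?_
      refine le_trans ?_ (ENNReal.ofReal_le_ofReal (h1 N))
      rw [ENNReal.ofReal_sum_of_nonneg (fun n _ => by positivity)]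
      refine Finset.sum_le_sum fun n _ => ?_
      rw [ENNReal.ofReal_mul (by positivity), ENNReal.ofReal_pow (by positivity),
        ENNReal.ofReal_inv_of_pos (by norm_num), ENNReal.ofReal_ofNat]
      gcongr
      exact h2 n)
  have hwae : ∀ᵐ x ∂μ, w x ≠ 0 := by
    have hms : MeasurableSet {x | w x = 0} := hwm (measurableSet_singleton 0)
    have hY := BanachFunctionSpace.carrier (μ := μ) (L := L) _ hms fun g => ?_
    · rw [ae_iff]
      simpa using hY
    · rw [ae_restrict_iff' hms]
      have hgm : AEMeasurable (fun x => ENNReal.ofReal ‖val μ ((‖g‖⁻¹ : ℂ) • g) x‖) μ :=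
        (aestronglyMeasurable_val μ _).norm.aemeasurable.ennreal_ofReal
      have h1 := hmax _ ⟨hgm.measurable_mk, (‖g‖⁻¹ : ℂ) • g, (by
        rw [norm_smul, norm_inv, Complex.norm_real, norm_norm]
        exact inv_mul_le_one), (by
          filter_upwards [hgm.ae_eq_mk] with x hx
          rw [← hx])⟩
      filter_upwards [h1, hgm.ae_eq_mk, val_smul μ (‖g‖⁻¹ : ℂ) g,
        val_zero μ L] with x h2 h3 h4 h9 h5
      have h6 := h2 h5
      rw [← h3, ENNReal.ofReal_eq_zero, h4] at h6
      have h7 := norm_eq_zero.1 (le_antisymm h6 (norm_nonneg _))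
      rcases mul_eq_zero.1 h7 with h8 | h8
      · have : g = 0 := by simpa using h8
        subst this
        exact h9
      · exact h8
  refine ⟨modulus μ f, ?_⟩
  filter_upwards [hwae, hf, val_modulus μ f] with x h1 h2 h3
  rw [h3]
  have : 0 < ‖val μ f x‖ := by
    by_contra h
    rw [ENNReal.ofReal_of_nonpos (not_lt.1 h)] at h2
    exact h1 (le_antisymm h2 bot_le)
  exact_mod_cast this

/-! ### Nonnegative kernels -/

theorem enorm_coe_nnreal_complex (r : ℝ≥0) : ‖(r : ℂ)‖ₑ = r := by
  rw [← ofReal_norm, Complex.norm_real, NNReal.norm_eq, ENNReal.ofReal_coe_nnreal]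

section Kernels

variable {X : Type*} [MeasurableSpace X] (μ : Measure X) {L : Type*}
  [NormedAddCommGroup L] [NormedSpace ℂ L] [CompleteSpace L] [BanachFunctionSpace μ L]

/-- `κ` is a nonnegative kernel of `T`, measurable and finite everywhere (every kernel that is
nonnegative almost everywhere has such a representative, see `exists_isNNKernel`). -/
def IsNNKernel (T : L →L[ℂ] L) (κ : X → X → ℝ≥0) : Prop :=
  Measurable (Function.uncurry κ) ∧
    ∀ f : L, ∀ᵐ x ∂μ, Integrable (fun y => (κ x y : ℂ) * val μ f y) μ ∧
      val μ (T f) x = ∫ y, (κ x y : ℂ) * val μ f y ∂μ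

variable {μ}

theorem HasKernel.congr [SigmaFinite μ] {T : L →L[ℂ] L} {κ κ' : X → X → ℂ} (h : HasKernel μ T κ)
    (hκ : ∀ᵐ p ∂μ.prod μ, κ p.1 p.2 = κ' p.1 p.2) : HasKernel μ T κ' := by
  refine ⟨h.1.congr hκ, fun f => ?_⟩
  filter_upwards [h.2 f, Measure.ae_ae_of_ae_prod hκ] with x h1 h2
  have e : (fun y => κ x y * BanachFunctionSpace.incl (μ := μ) f y) =ᵐ[μ]
      fun y => κ' x y * BanachFunctionSpace.incl (μ := μ) f y := by
    filter_upwards [h2] with y hy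
    rw [hy]
  exact ⟨h1.1.congr e, h1.2.trans (integral_congr_ae e)⟩

theorem IsNNKernel.hasKernel {T : L →L[ℂ] L} {κ : X → X → ℝ≥0} (h : IsNNKernel μ T κ) :
    HasKernel μ T (fun x y => (κ x y : ℂ)) :=
  ⟨(Complex.measurable_ofReal.comp h.1.coe_nnreal_real).aestronglyMeasurable, h.2⟩

theorem exists_isNNKernel [SigmaFinite μ] {T : L →L[ℂ] L} {a : X → X → ℝ}
    (ha : ∀ᵐ p ∂μ.prod μ, 0 ≤ a p.1 p.2) (hT : HasKernel μ T (fun x y => (a x y : ℂ))) :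
    ∃ κ : X → X → ℝ≥0, IsNNKernel μ T κ ∧ ∀ᵐ p ∂μ.prod μ, a p.1 p.2 = κ p.1 p.2 := by
  have hm : AEMeasurable (fun p : X × X => (a p.1 p.2).toNNReal) (μ.prod μ) :=
    (Complex.measurable_re.comp_aemeasurable hT.1.aemeasurable).real_toNNReal
  have he : ∀ᵐ p ∂μ.prod μ, a p.1 p.2 = hm.mk _ p := by
    filter_upwards [ha, hm.ae_eq_mk] with p h1 h2
    rw [← h2, Real.coe_toNNReal _ h1]
  refine ⟨fun x y => hm.mk _ (x, y), ⟨hm.measurable_mk, ?_⟩, he⟩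
  refine (hT.congr (κ' := fun x y => ((hm.mk _ (x, y) : ℝ≥0) : ℂ)) ?_).2
  filter_upwards [he] with p hp
  rw [hp]

namespace IsNNKernel

variable {T : L →L[ℂ] L} {κ : X → X → ℝ≥0}

theorem measurable_section (h : IsNNKernel μ T κ) (x : X) : Measurable (κ x) :=
  h.1.comp measurable_prodMk_left

/-- On the modulus, a positive kernel operator is given by a Lebesgue integral. -/
theorem val_modulus_eq (h : IsNNKernel μ T κ) (f : L) : ∀ᵐ x ∂μ,
    ∫⁻ y, κ x y * ‖val μ f y‖ₑ ∂μ ≠ ∞ ∧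
      val μ (T (modulus μ f)) x = ((∫⁻ y, κ x y * ‖val μ f y‖ₑ ∂μ).toReal : ℂ) := by
  filter_upwards [h.2 (modulus μ f)] with x hx
  have e : (fun y => (κ x y : ℂ) * val μ (modulus μ f) y) =ᵐ[μ]
      fun y => ((κ x y * ‖val μ f y‖ : ℝ) : ℂ) := by
    filter_upwards [val_modulus μ f] with y hy
    rw [hy]; push_cast; rfl
  have hi : Integrable (fun y => (κ x y * ‖val μ f y‖ : ℝ)) μ := by
    have := (hx.1.congr e).re
    simpa using this
  have e2 : ∫⁻ y, κ x y * ‖val μ f y‖ₑ ∂μ = ∫⁻ y, ‖(κ x y * ‖val μ f y‖ : ℝ)‖ₑ ∂μ := by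
    refine lintegral_congr fun y => ?_
    rw [enorm_mul, enorm_norm, Real.enorm_of_nonneg (by positivity), ENNReal.ofReal_coe_nnreal]
  refine ⟨?_, ?_⟩
  · rw [e2]
    exact hi.2.ne
  · rw [hx.2, integral_congr_ae e, integral_complex_ofReal, e2,
      ← integral_norm_eq_lintegral_enorm hi.1]
    congr 1
    refine integral_congr_ae (ae_of_all _ fun y => ?_)
    exact (Real.norm_of_nonneg (by positivity)).symm

theorem enorm_val_le (h : IsNNKernel μ T κ) (f : L) : ∀ᵐ x ∂μ,
    ‖val μ (T f) x‖ₑ ≤ ∫⁻ y, κ x y * ‖val μ f y‖ₑ ∂μ := by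
  filter_upwards [h.2 f] with x hx
  rw [hx.2]
  refine (enorm_integral_le_lintegral_enorm _).trans (lintegral_mono fun y => ?_)
  rw [enorm_mul, enorm_coe_nnreal_complex]

theorem enorm_val_modulus (h : IsNNKernel μ T κ) (f : L) : ∀ᵐ x ∂μ,
    ‖val μ (T (modulus μ f)) x‖ₑ = ∫⁻ y, κ x y * ‖val μ f y‖ₑ ∂μ := by
  filter_upwards [h.val_modulus_eq f] with x hx
  rw [hx.2, ← ofReal_norm, Complex.norm_real, Real.norm_of_nonneg ENNReal.toReal_nonneg,
    ENNReal.ofReal_toReal hx.1]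

theorem add {T' : L →L[ℂ] L} {κ' : X → X → ℝ≥0} (h : IsNNKernel μ T κ) (h' : IsNNKernel μ T' κ') :
    IsNNKernel μ (T + T') (fun x y => κ x y + κ' x y) := by
  refine ⟨h.1.add h'.1, fun f => ?_⟩
  filter_upwards [h.2 f, h'.2 f, val_add μ (T f) (T' f)] with x h1 h2 h3
  have e : (fun y => ((κ x y + κ' x y : ℝ≥0) : ℂ) * val μ f y) =
      fun y => (κ x y : ℂ) * val μ f y + (κ' x y : ℂ) * val μ f y := by
    funext y; push_cast; ring
  rw [e]
  refine ⟨h1.1.add h2.1, ?_⟩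
  rw [add_apply, h3, h1.2, h2.2, integral_add h1.1 h2.1]

theorem zero : IsNNKernel μ (0 : L →L[ℂ] L) (fun _ _ => 0) := by
  refine ⟨measurable_const, fun f => ?_⟩
  filter_upwards [val_zero μ L] with x h1
  simp [h1]

theorem smul (h : IsNNKernel μ T κ) (c : ℝ≥0) :
    IsNNKernel μ ((c : ℂ) • T) (fun x y => c * κ x y) := by
  refine ⟨h.1.const_mul c, fun f => ?_⟩
  filter_upwards [h.2 f, val_smul μ c (T f)] with x h1 h2
  have e : (fun y => ((c * κ x y : ℝ≥0) : ℂ) * val μ f y) =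
      fun y => (c : ℂ) * ((κ x y : ℂ) * val μ f y) := by
    funext y; push_cast; ring
  rw [e]
  refine ⟨h1.1.const_mul _, ?_⟩
  rw [smul_apply, h2, h1.2, integral_const_mul]

theorem sum {ι : Type*} (s : Finset ι) {T : ι → L →L[ℂ] L} {κ : ι → X → X → ℝ≥0}
    (h : ∀ i, IsNNKernel μ (T i) (κ i)) :
    IsNNKernel μ (∑ i ∈ s, T i) (fun x y => ∑ i ∈ s, κ i x y) := by
  classical
  induction s using Finset.induction with
  | empty => simpa using zero
  | insert i s hi ih =>
    simp only [Finset.sum_insert hi]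
    exact (h i).add ih

end IsNNKernel

/-- A kernel between `0` and the kernel of an operator is the kernel of an operator. -/
theorem IsNNKernel.exists_of_le [SigmaFinite μ] {S : L →L[ℂ] L} {s t : X → X → ℝ≥0}
    (hS : IsNNKernel μ S s) (ht : Measurable (Function.uncurry t))
    (hle : ∀ᵐ p ∂μ.prod μ, t p.1 p.2 ≤ s p.1 p.2) : ∃ T : L →L[ℂ] L, IsNNKernel μ T t := by
  have hmeas : ∀ f : L, AEStronglyMeasurable
      (fun p : X × X => (t p.1 p.2 : ℂ) * val μ f p.2) (μ.prod μ) := fun f =>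
    (Complex.measurable_ofReal.comp ht.coe_nnreal_real).aestronglyMeasurable.mul
      (aestronglyMeasurable_val μ f).comp_snd
  have hpt : ∀ f : L, ∀ᵐ x ∂μ, Integrable (fun y => (t x y : ℂ) * val μ f y) μ ∧
      ‖∫ y, (t x y : ℂ) * val μ f y ∂μ‖ ≤ ‖val μ (S (modulus μ f)) x‖ := by
    intro f
    filter_upwards [hS.val_modulus_eq f, (hmeas f).prodMk_left,
      Measure.ae_ae_of_ae_prod hle] with x h1 h2 h3
    have h4 : ∫⁻ y, ‖(t x y : ℂ) * val μ f y‖ₑ ∂μ ≤ ∫⁻ y, s x y * ‖val μ f y‖ₑ ∂μ := by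
      refine lintegral_mono_ae ?_
      filter_upwards [h3] with y hy
      rw [enorm_mul, enorm_coe_nnreal_complex]
      gcongr
    refine ⟨⟨h2, lt_of_le_of_lt h4 h1.1.lt_top⟩, ?_⟩
    rw [h1.2, Complex.norm_real, Real.norm_of_nonneg ENNReal.toReal_nonneg]
    refine (ENNReal.ofReal_le_iff_le_toReal h1.1).1 ?_
    rw [ofReal_norm]
    exact (enorm_integral_le_lintegral_enorm _).trans h4
  have hex : ∀ f : L, ∃ h : L, val μ h =ᵐ[μ] fun x => ∫ y, (t x y : ℂ) * val μ f y ∂μ := fun f =>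
    exists_val_ae_eq μ (S (modulus μ f)) (hmeas f).integral_prod_right'
      (by filter_upwards [hpt f] with x hx using hx.2)
  choose T hT using hex
  let T' : L →ₗ[ℂ] L :=
    { toFun := T
      map_add' := fun u v => ext_of_val_ae_eq μ (by
        filter_upwards [val_add μ (T u) (T v), hT (u + v), hT u, hT v, hpt u, hpt v]
          with x h1 h2 h3 h4 h5 h6
        rw [h1, h2, h3, h4, ← integral_add h5.1 h6.1]
        refine integral_congr_ae ?_
        filter_upwards [val_add μ u v] with y hy
        rw [hy, mul_add])
      map_smul' := fun c u => ext_of_val_ae_eq μ (by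
        filter_upwards [val_smul μ c (T u), hT (c • u), hT u] with x h1 h2 h3
        rw [RingHom.id_apply, h1, h2, h3, ← integral_const_mul]
        refine integral_congr_ae ?_
        filter_upwards [val_smul μ c u] with y hy
        rw [hy, mul_left_comm]) }
  have hb : ∀ f, ‖T' f‖ ≤ ‖S‖ * ‖f‖ := fun f => by
    refine (norm_le_of_val_ae_le μ (g := S (modulus μ f)) ?_).trans ?_
    · filter_upwards [hT f, hpt f] with x h1 h2
      change ‖val μ (T f) x‖ ≤ _
      rw [h1]
      exact h2.2
    · rw [← norm_modulus μ f]
      exact S.le_opNorm _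
  refine ⟨T'.mkContinuous _ hb, ht, fun f => ?_⟩
  filter_upwards [hT f, hpt f] with x h1 h2
  exact ⟨h2.1, h1⟩

/-- The composition of two nonnegative kernels. -/
noncomputable def compKernel (μ : Measure X) (κ κ' : X → X → ℝ≥0) (x y : X) : ℝ≥0∞ :=
  ∫⁻ z, κ x z * κ' z y ∂μ

theorem measurable_compKernel [SigmaFinite μ] {κ κ' : X → X → ℝ≥0}
    (h : Measurable (Function.uncurry κ)) (h' : Measurable (Function.uncurry κ')) :
    Measurable (Function.uncurry (compKernel μ κ κ')) := by
  have : Measurable fun q : (X × X) × X =>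
      ((κ q.1.1 q.2 : ℝ≥0∞) * (κ' q.2 q.1.2 : ℝ≥0∞)) := by
    refine Measurable.fun_mul ?_ ?_
    · exact (h.comp (f := fun q : (X × X) × X => (q.1.1, q.2)) (by fun_prop)).coe_nnreal_ennreal
    · exact (h'.comp (f := fun q : (X × X) × X => (q.2, q.1.2)) (by fun_prop)).coe_nnreal_ennreal
  exact this.lintegral_prod_right'

theorem lintegral_compKernel_mul [SigmaFinite μ] {κ κ' : X → X → ℝ≥0}
    (h : Measurable (Function.uncurry κ)) (h' : Measurable (Function.uncurry κ'))
    {g : X → ℝ≥0∞} (hg : AEMeasurable g μ) (x : X) :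
    ∫⁻ y, compKernel μ κ κ' x y * g y ∂μ = ∫⁻ z, κ x z * ∫⁻ y, κ' z y * g y ∂μ ∂μ := by
  have hx : Measurable (κ x) := h.comp measurable_prodMk_left
  have hz : ∀ z, Measurable (κ' z) := fun z => h'.comp measurable_prodMk_left
  have hy : ∀ y, Measurable fun z => κ' z y := fun y => h'.comp measurable_prodMk_right
  have e1 : ∀ y, compKernel μ κ κ' x y * g y = ∫⁻ z, κ x z * κ' z y * g y ∂μ := fun y => by
    rw [compKernel, lintegral_mul_const _ (by have := hy y; fun_prop)]
  simp only [e1]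
  rw [lintegral_lintegral_swap]
  · refine lintegral_congr fun z => ?_
    simp only [mul_assoc]
    rw [lintegral_const_mul'' _ (by have := hz z; fun_prop)]
  · refine AEMeasurable.mul ?_ ?_
    · refine Measurable.aemeasurable (Measurable.fun_mul ?_ ?_)
      · exact (hx.comp measurable_snd).coe_nnreal_ennreal
      · exact (h'.comp (f := fun q : X × X => (q.2, q.1)) (by fun_prop)).coe_nnreal_ennreal
    · exact hg.comp_fst

/-- The composition of the kernels of two operators is finite almost everywhere, since its integral
against a strictly positive element of `L` is. -/
theorem ae_compKernel_ne_top [SigmaFinite μ] {A B : L →L[ℂ] L} {κ κ' : X → X → ℝ≥0}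
    (hA : IsNNKernel μ A κ) (hB : IsNNKernel μ B κ') :
    ∀ᵐ p ∂μ.prod μ, compKernel μ κ κ' p.1 p.2 ≠ ∞ := by
  have hm := measurable_compKernel (μ := μ) hA.1 hB.1
  have hms : MeasurableSet {p : X × X | compKernel μ κ κ' p.1 p.2 ≠ ∞} :=
    hm (measurableSet_singleton ∞).compl
  rw [Measure.ae_prod_iff_ae_ae hms]
  obtain ⟨e, he⟩ := exists_val_pos μ L
  filter_upwards [hA.val_modulus_eq (B (modulus μ e))] with x hx
  have h1 : ∫⁻ y, compKernel μ κ κ' x y * ‖val μ e y‖ₑ ∂μ ≠ ∞ := by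
    rw [lintegral_compKernel_mul hA.1 hB.1 (aestronglyMeasurable_val μ e).enorm]
    convert hx.1 using 1
    refine lintegral_congr_ae ?_
    filter_upwards [hB.enorm_val_modulus e] with z hz
    rw [hz]
  have h2 : AEMeasurable (fun y => compKernel μ κ κ' x y * ‖val μ e y‖ₑ) μ :=
    (hm.comp measurable_prodMk_left).aemeasurable.mul (aestronglyMeasurable_val μ e).enorm
  filter_upwards [ae_lt_top' h2 h1, he] with y hy hey h3
  rw [h3, ENNReal.top_mul (by simpa using hey.ne')] at hy
  exact lt_irrefl _ hy

theorem IsNNKernel.mul [SigmaFinite μ] {A B : L →L[ℂ] L} {κ κ' : X → X → ℝ≥0}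
    (hA : IsNNKernel μ A κ) (hB : IsNNKernel μ B κ') :
    IsNNKernel μ (A * B) (fun x y => (compKernel μ κ κ' x y).toNNReal) := by
  refine ⟨(measurable_compKernel hA.1 hB.1).ennreal_toNNReal, fun f => ?_⟩
  filter_upwards [hA.2 (B f), hA.val_modulus_eq (B (modulus μ f))] with x h1 h2
  have hx := hA.measurable_section x
  have hF : AEStronglyMeasurable
      (Function.uncurry fun z y => (κ x z : ℂ) * ((κ' z y : ℂ) * val μ f y)) (μ.prod μ) := by
    refine AEStronglyMeasurable.mul ?_ (AEStronglyMeasurable.mul ?_ ?_)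
    · have : Measurable fun p : X × X => (κ x p.1 : ℂ) :=
        Complex.measurable_ofReal.comp (hx.comp measurable_fst).coe_nnreal_real
      exact this.aestronglyMeasurable
    · exact (Complex.measurable_ofReal.comp hB.1.coe_nnreal_real).aestronglyMeasurable
    · exact (aestronglyMeasurable_val μ f).comp_snd
  have hfin : ∫⁻ z, κ x z * ∫⁻ y, κ' z y * ‖val μ f y‖ₑ ∂μ ∂μ ≠ ∞ := by
    convert h2.1 using 1
    refine lintegral_congr_ae ?_
    filter_upwards [hB.enorm_val_modulus f] with z hz
    rw [hz]
  have hFi : Integrable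
      (Function.uncurry fun z y => (κ x z : ℂ) * ((κ' z y : ℂ) * val μ f y)) (μ.prod μ) := by
    refine ⟨hF, ?_⟩
    rw [hasFiniteIntegral_iff_enorm, lintegral_prod _ hF.enorm]
    refine lt_of_eq_of_lt ?_ hfin.lt_top
    refine lintegral_congr fun z => ?_
    simp only [Function.uncurry_apply_pair, enorm_mul, enorm_coe_nnreal_complex]
    rw [lintegral_const_mul'']
    exact (hB.measurable_section z).coe_nnreal_ennreal.aemeasurable.mul
      (aestronglyMeasurable_val μ f).enorm
  have hy : ∀ y, ∫ z, (κ x z : ℂ) * ((κ' z y : ℂ) * val μ f y) ∂μ =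
      ((compKernel μ κ κ' x y).toNNReal : ℂ) * val μ f y := by
    intro y
    simp only [← mul_assoc]
    rw [integral_mul_const]
    congr 1
    have e : (fun z => (κ x z : ℂ) * (κ' z y : ℂ)) = fun z => ((κ x z * κ' z y : ℝ) : ℂ) := by
      funext z; push_cast; rfl
    have hyz : Measurable fun z => κ' z y := hB.1.comp measurable_prodMk_right
    rw [e, integral_complex_ofReal, integral_eq_lintegral_of_nonneg_ae
      (ae_of_all _ fun z => by positivity) (by fun_prop)]
    congr 1
    rw [compKernel, ENNReal.coe_toNNReal_eq_toReal]
    congr 1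
    refine lintegral_congr fun z => ?_
    rw [ENNReal.ofReal_mul (by positivity), ENNReal.ofReal_coe_nnreal, ENNReal.ofReal_coe_nnreal]
  refine ⟨?_, ?_⟩
  · refine hFi.integral_prod_right.congr (ae_of_all _ fun y => ?_)
    exact hy y
  · change val μ (A (B f)) x = _
    rw [h1.2]
    have e : ∫ z, (κ x z : ℂ) * val μ (B f) z ∂μ =
        ∫ z, ∫ y, (κ x z : ℂ) * ((κ' z y : ℂ) * val μ f y) ∂μ ∂μ := by
      refine integral_congr_ae ?_
      filter_upwards [hB.2 f] with z hz
      rw [hz.2, integral_const_mul]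
    rw [e, integral_integral_swap hFi]
    exact integral_congr_ae (ae_of_all _ hy)

end Kernels

/-! ### Domination by Hadamard means -/

section Domination

variable {X : Type*} [MeasurableSpace X] (μ : Measure X) {L : Type*}
  [NormedAddCommGroup L] [NormedSpace ℂ L] [CompleteSpace L] [BanachFunctionSpace μ L]

/-- `T` and `S` have nonnegative kernels, and the kernel of `T` is at most the kernel of `S`. -/
def KernelLE (T S : L →L[ℂ] L) : Prop :=
  ∃ t s : X → X → ℝ≥0, IsNNKernel μ T t ∧ IsNNKernel μ S s ∧ ∀ᵐ p ∂μ.prod μ, t p.1 p.2 ≤ s p.1 p.2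

/-- The kernel of `T` is at most the weighted geometric mean of the kernels of the `A j`. -/
def MeanDominated {m : ℕ} (α : Fin m → ℝ) (T : L →L[ℂ] L) (A : Fin m → L →L[ℂ] L) : Prop :=
  ∃ (t : X → X → ℝ≥0) (κ : Fin m → X → X → ℝ≥0), IsNNKernel μ T t ∧
    (∀ j, IsNNKernel μ (A j) (κ j)) ∧ ∀ᵐ p ∂μ.prod μ, t p.1 p.2 ≤ ∏ j, κ j p.1 p.2 ^ α j

variable {μ}
variable {m : ℕ} {α : Fin m → ℝ}

theorem IsHadamardMean.meanDominated [SigmaFinite μ] {A : Fin m → L →L[ℂ] L} {T : L →L[ℂ] L}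
    (h : IsHadamardMean μ α A T) : MeanDominated μ α T A := by
  obtain ⟨a, ha, hA, hT⟩ := h
  have hpos : ∀ᵐ p ∂μ.prod μ, 0 ≤ ∏ j, a j p.1 p.2 ^ α j := by
    filter_upwards [ae_all_iff.2 ha] with p hp
    exact Finset.prod_nonneg fun j _ => Real.rpow_nonneg (hp j) _
  obtain ⟨t, ht, hta⟩ := exists_isNNKernel hpos hT
  choose κ hκ hκa using fun j => exists_isNNKernel (ha j) (hA j)
  refine ⟨t, κ, ht, hκ, ?_⟩
  filter_upwards [hta, ae_all_iff.2 hκa] with p h1 h2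
  rw [← NNReal.coe_le_coe, ← h1]
  push_cast
  simp [h2]

/-- The weighted arithmetic–geometric mean inequality for kernels. Rescaling the `A j` by weights
`c j` whose weighted geometric mean is `1` does not change the geometric mean of the kernels. -/
theorem prod_rpow_le_sum (hα : ∀ j, 0 < α j) (hsum : ∑ j, α j = 1) (c : Fin m → ℝ≥0)
    (hc : ∏ j, c j ^ α j = 1) (κ : Fin m → ℝ≥0) :
    ∏ j, κ j ^ α j ≤ ∑ j, (α j).toNNReal * c j * κ j := by
  have ha : ∑ j, (α j).toNNReal = 1 := by
    rw [← NNReal.coe_inj]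
    push_cast
    simpa only [Real.coe_toNNReal _ (hα _).le] using hsum
  have h := NNReal.geom_mean_le_arith_mean_weighted Finset.univ (fun j => (α j).toNNReal)
    (fun j => c j * κ j) ha
  simp only [Real.coe_toNNReal _ (hα _).le, NNReal.mul_rpow, Finset.prod_mul_distrib, hc,
    one_mul, ← mul_assoc] at h
  exact h

theorem MeanDominated.exists_isHadamardMean [SigmaFinite μ] {A : Fin m → L →L[ℂ] L}
    {T : L →L[ℂ] L} (h : MeanDominated μ α T A) (hα : ∀ j, 0 < α j) (hsum : ∑ j, α j = 1) :
    ∃ S, IsHadamardMean μ α A S ∧ KernelLE μ T S := by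
  obtain ⟨t, κ, ht, hκ, hle⟩ := h
  have hm : Measurable (Function.uncurry fun x y => ∏ j, κ j x y ^ α j) :=
    Finset.measurable_fun_prod _ fun j _ => (hκ j).1.pow_const (α j)
  obtain ⟨S, hS⟩ := (IsNNKernel.sum Finset.univ fun j =>
    (hκ j).smul ((α j).toNNReal * 1)).exists_of_le hm
    (ae_of_all _ fun p => prod_rpow_le_sum hα hsum (fun _ => 1) (by simp) _)
  refine ⟨S, ⟨fun j x y => κ j x y, fun j => ae_of_all _ fun p => NNReal.coe_nonneg _,
    fun j => (hκ j).hasKernel, ?_⟩, t, _, ht, hS, hle⟩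
  have := hS.hasKernel
  push_cast at this ⊢
  exact this

/-- Hölder's inequality: compositions of geometric means of kernels are at most the geometric
means of the compositions. -/
theorem MeanDominated.mul [SigmaFinite μ] {A A' : Fin m → L →L[ℂ] L} {T T' : L →L[ℂ] L}
    (h : MeanDominated μ α T A) (h' : MeanDominated μ α T' A') (hα : ∀ j, 0 < α j)
    (hsum : ∑ j, α j = 1) : MeanDominated μ α (T * T') (fun j => A j * A' j) := by
  obtain ⟨t, κ, ht, hκ, hle⟩ := h
  obtain ⟨t', κ', ht', hκ', hle'⟩ := h'
  refine ⟨_, _, ht.mul ht', fun j => (hκ j).mul (hκ' j), ?_⟩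
  have h1 : ∀ᵐ p ∂μ.prod μ, ∀ᵐ z ∂μ, t p.1 z ≤ ∏ j, κ j p.1 z ^ α j :=
    Measure.quasiMeasurePreserving_fst.ae (Measure.ae_ae_of_ae_prod hle)
  have h2 : ∀ᵐ p ∂μ.prod μ, ∀ᵐ z ∂μ, t' z p.2 ≤ ∏ j, κ' j z p.2 ^ α j :=
    Measure.quasiMeasurePreserving_snd.ae (Measure.ae_ae_of_ae_prod
      (Measure.measurePreserving_swap.quasiMeasurePreserving.ae hle'))
  filter_upwards [h1, h2, ae_all_iff.2 fun j => ae_compKernel_ne_top (hκ j) (hκ' j)] with p h3 h4 h5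
  have key : compKernel μ t t' p.1 p.2 ≤ ∏ j, compKernel μ (κ j) (κ' j) p.1 p.2 ^ α j := by
    refine le_trans ?_ (ENNReal.lintegral_prod_norm_pow_le Finset.univ (fun j _ => ?_) hsum
      (fun j _ => (hα j).le))
    · refine lintegral_mono_ae ?_
      filter_upwards [h3, h4] with z h6 h7
      calc (t p.1 z * t' z p.2 : ℝ≥0∞)
          ≤ ((∏ j, κ j p.1 z ^ α j : ℝ≥0) : ℝ≥0∞) * ((∏ j, κ' j z p.2 ^ α j : ℝ≥0) : ℝ≥0∞) := by
            gcongr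
        _ = _ := by
            push_cast
            rw [← Finset.prod_mul_distrib]
            refine Finset.prod_congr rfl fun j _ => ?_
            rw [ENNReal.mul_rpow_of_nonneg _ _ (hα j).le, ENNReal.coe_rpow_of_nonneg _ (hα j).le,
              ENNReal.coe_rpow_of_nonneg _ (hα j).le]
    · have e1 := (hκ j).measurable_section p.1
      have e2 : Measurable fun z => κ' j z p.2 := (hκ' j).1.comp measurable_prodMk_right
      fun_prop
  have h6 : ∏ j, compKernel μ (κ j) (κ' j) p.1 p.2 ^ α j =
      ((∏ j, (compKernel μ (κ j) (κ' j) p.1 p.2).toNNReal ^ α j : ℝ≥0) : ℝ≥0∞) := by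
    push_cast
    refine Finset.prod_congr rfl fun j _ => ?_
    rw [ENNReal.coe_rpow_of_nonneg _ (hα j).le, ENNReal.coe_toNNReal (h5 j)]
  rw [h6] at key
  exact (ENNReal.toNNReal_mono ENNReal.coe_ne_top key).trans_eq (ENNReal.toNNReal_coe _)

/-- Hölder's inequality for finite sums. -/
theorem sum_prod_rpow_le {ι : Type*} [Fintype ι] (hα : ∀ j, 0 < α j) (hsum : ∑ j, α j = 1)
    (a : ι → Fin m → ℝ≥0) : ∑ i, ∏ j, a i j ^ α j ≤ ∏ j, (∑ i, a i j) ^ α j := by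
  let _ : MeasurableSpace ι := ⊤
  have := ENNReal.lintegral_prod_norm_pow_le (μ := Measure.count) (α := ι) Finset.univ
    (f := fun j i => (a i j : ℝ≥0∞)) (fun j _ => (measurable_of_finite _).aemeasurable) hsum
    (fun j _ => (hα j).le)
  simp only [lintegral_count, tsum_fintype] at this
  rw [← ENNReal.coe_le_coe]
  push_cast
  simpa only [ENNReal.coe_rpow_of_nonneg _ (hα _).le, ENNReal.ofNNReal_finsetSum] using this

theorem MeanDominated.sum {k : ℕ} {A : Fin k → Fin m → L →L[ℂ] L} {T : Fin k → L →L[ℂ] L}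
    (h : ∀ i, MeanDominated μ α (T i) (A i)) (hα : ∀ j, 0 < α j) (hsum : ∑ j, α j = 1) :
    MeanDominated μ α (∑ i, T i) (fun j => ∑ i, A i j) := by
  choose t κ ht hκ hle using h
  refine ⟨_, _, IsNNKernel.sum Finset.univ ht,
    fun j => IsNNKernel.sum Finset.univ fun i => hκ i j, ?_⟩
  filter_upwards [ae_all_iff.2 hle] with p hp
  exact (Finset.sum_le_sum fun i _ => hp i).trans (sum_prod_rpow_le hα hsum _)

theorem exists_meanDominated_of_mem_prod [SigmaFinite μ] (hα : ∀ j, 0 < α j)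
    (hsum : ∑ j, α j = 1) {k : ℕ} (Ψ : Fin (k + 1) → Fin m → Set (L →L[ℂ] L)) (T : L →L[ℂ] L)
    (hT : T ∈ (List.ofFn fun i => hadamardMeanSet μ α (Ψ i)).prod) :
    ∃ A : Fin m → L →L[ℂ] L, (∀ j, A j ∈ (List.ofFn fun i => Ψ i j).prod) ∧
      MeanDominated μ α T A := by
  induction k generalizing T with
  | zero =>
    simp only [List.ofFn_succ, List.ofFn_zero, List.prod_cons, List.prod_nil, mul_one] at hT ⊢
    obtain ⟨A, hA, hm⟩ := hT
    exact ⟨A, hA, hm.meanDominated⟩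
  | succ k ih =>
    rw [List.ofFn_succ, List.prod_cons] at hT
    obtain ⟨T₁, ⟨A, hA, hm⟩, T₂, hT₂, rfl⟩ := hT
    obtain ⟨B, hB, hBm⟩ := ih _ _ hT₂
    refine ⟨fun j => A j * B j, fun j => ?_, hm.meanDominated.mul hBm hα hsum⟩
    rw [List.ofFn_succ, List.prod_cons]
    exact Set.mul_mem_mul (hA j) (hB j)

theorem exists_meanDominated_of_mem_sum [SigmaFinite μ] (hα : ∀ j, 0 < α j)
    (hsum : ∑ j, α j = 1) {k : ℕ} (Ψ : Fin k → Fin m → Set (L →L[ℂ] L)) (T : L →L[ℂ] L)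
    (hT : T ∈ ∑ i, hadamardMeanSet μ α (Ψ i)) :
    ∃ A : Fin m → L →L[ℂ] L, (∀ j, A j ∈ ∑ i, Ψ i j) ∧ MeanDominated μ α T A := by
  obtain ⟨T, hmem, rfl⟩ := Set.mem_fintype_sum _ _ |>.1 hT
  have hT' : ∀ i, ∃ A : Fin m → L →L[ℂ] L, (∀ j, A j ∈ Ψ i j) ∧ IsHadamardMean μ α A (T i) :=
    fun i => hmem i
  choose A hA hm using hT'
  exact ⟨_, fun j => Set.mem_fintype_sum _ _ |>.2 ⟨fun i => A i j, fun i => hA i j, rfl⟩,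
    MeanDominated.sum (fun i => (hm i).meanDominated) hα hsum⟩

end Domination

/-! ### Inequalities for monotone seminorms -/

section Seminorm

variable {X : Type*} [MeasurableSpace X] (μ : Measure X) {L : Type*}
  [NormedAddCommGroup L] [NormedSpace ℂ L] [CompleteSpace L] [BanachFunctionSpace μ L]

/-- A quantity for operators on `L` that behaves like a seminorm, and that is monotone on
operators with nonnegative kernels. -/
structure IsMonotoneSeminorm (ρ : (L →L[ℂ] L) → ℝ) : Prop where
  nonneg : ∀ A, 0 ≤ ρ A
  add_le : ∀ A B, ρ (A + B) ≤ ρ A + ρ B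
  smul_le : ∀ (c : ℝ≥0) (A), ρ ((c : ℂ) • A) ≤ c * ρ A
  mono : ∀ T S, KernelLE μ T S → ρ T ≤ ρ S

variable {μ}
variable {ρ : (L →L[ℂ] L) → ℝ} {m : ℕ} {α : Fin m → ℝ}

theorem IsMonotoneSeminorm.sum_le (hρ : IsMonotoneSeminorm μ ρ) {ι : Type*} (s : Finset ι)
    (A : ι → L →L[ℂ] L) : ρ (∑ i ∈ s, A i) ≤ ∑ i ∈ s, ρ (A i) := by
  classical
  induction s using Finset.induction with
  | empty => simpa using hρ.smul_le 0 0
  | insert i s hi ih =>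
    rw [Finset.sum_insert hi, Finset.sum_insert hi]
    exact (hρ.add_le _ _).trans (by gcongr)

/-- By `prod_rpow_le_sum`, `ρ T` is bounded by the weighted arithmetic means of the rescaled `ρ (A j)`, the least of which is their geometric mean. -/
theorem IsMonotoneSeminorm.le_prod_rpow (hρ : IsMonotoneSeminorm μ ρ) (hα : ∀ j, 0 < α j)
    (hsum : ∑ j, α j = 1) {T : L →L[ℂ] L} {A : Fin m → L →L[ℂ] L} (h : MeanDominated μ α T A) :
    ρ T ≤ ∏ j, ρ (A j) ^ α j := by
  obtain ⟨t, κ, ht, hκ, hle⟩ := h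
  have key : ∀ c : Fin m → ℝ≥0, ∏ j, c j ^ α j = 1 → ρ T ≤ ∑ j, α j * (c j * ρ (A j)) := by
    intro c hc
    have h1 : KernelLE μ T (∑ j, (((α j).toNNReal * c j : ℝ≥0) : ℂ) • A j) := by
      refine ⟨t, _, ht, IsNNKernel.sum Finset.univ fun j => (hκ j).smul _, ?_⟩
      filter_upwards [hle] with p hp
      exact hp.trans (prod_rpow_le_sum hα hsum c hc _)
    refine (hρ.mono _ _ h1).trans ((hρ.sum_le _ _).trans (Finset.sum_le_sum fun j _ => ?_))
    refine (hρ.smul_le _ _).trans (le_of_eq ?_)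
    push_cast
    rw [mul_assoc, Real.coe_toNNReal _ (hα j).le]
  have hε : ∀ ε : ℝ, 0 < ε → ρ T ≤ ∏ j, (ρ (A j) + ε) ^ α j := by
    intro ε hε
    let r : Fin m → ℝ≥0 := fun j => ⟨ρ (A j) + ε, add_nonneg (hρ.nonneg _) hε.le⟩
    have hr : ∀ j, 0 < r j := fun j => by
      rw [← NNReal.coe_pos]
      exact add_pos_of_nonneg_of_pos (hρ.nonneg _) hε
    let P : ℝ≥0 := ∏ j, r j ^ α j
    have hP : 0 < P := Finset.prod_pos fun j _ => NNReal.rpow_pos (hr j)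
    have h1 := key (fun j => P / r j) (by
      simp only [NNReal.div_rpow, Finset.prod_div_distrib]
      have h2 : ∏ j, P ^ α j = P := by
        rw [← NNReal.coe_inj]
        push_cast
        rw [← Real.rpow_sum_of_pos (NNReal.coe_pos.2 hP), hsum, Real.rpow_one]
      rw [h2, div_self hP.ne'])
    have hPe : (P : ℝ) = ∏ j, (ρ (A j) + ε) ^ α j := by
      simp only [P]; push_cast; rfl
    rw [← hPe]
    refine h1.trans ?_
    calc ∑ j, α j * ((P / r j : ℝ≥0) * ρ (A j)) ≤ ∑ j, α j * P := by
          refine Finset.sum_le_sum fun j _ => mul_le_mul_of_nonneg_left ?_ (hα j).le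
          push_cast
          rw [div_mul_eq_mul_div, div_le_iff₀ (NNReal.coe_pos.2 (hr j))]
          refine mul_le_mul_of_nonneg_left ?_ P.2
          exact le_add_of_nonneg_right hε.le
      _ = P := by rw [← Finset.sum_mul, hsum, one_mul]
  have hlim : Tendsto (fun ε : ℝ => ∏ j, (ρ (A j) + ε) ^ α j) (𝓝[>] 0)
      (𝓝 (∏ j, (ρ (A j) + 0) ^ α j)) := by
    refine tendsto_nhdsWithin_of_tendsto_nhds ?_
    refine tendsto_finsetProd _ fun j _ => ?_
    exact (tendsto_const_nhds.add tendsto_id).rpow_const (Or.inr (hα j).le)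
  simp only [add_zero] at hlim
  exact ge_of_tendsto hlim (by filter_upwards [self_mem_nhdsWithin] with ε h using hε ε h)

theorem IsMonotoneSeminorm.supOver_hadamardMeanSet_le [SigmaFinite μ]
    (hρ : IsMonotoneSeminorm μ ρ) (hα : ∀ j, 0 < α j)
    (hsum : ∑ j, α j = 1) (Φ : Fin m → Set (L →L[ℂ] L)) :
    supOver ρ (hadamardMeanSet μ α Φ) ≤ ∏ j, supOver ρ (Φ j) ^ α j := by
  refine iSup₂_le fun S hS => ?_
  obtain ⟨A, hA, hm⟩ := hS
  calc ENNReal.ofReal (ρ S) ≤ ENNReal.ofReal (∏ j, ρ (A j) ^ α j) :=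
        ENNReal.ofReal_le_ofReal (hρ.le_prod_rpow hα hsum hm.meanDominated)
    _ = ∏ j, ENNReal.ofReal (ρ (A j)) ^ α j := by
        rw [ENNReal.ofReal_prod_of_nonneg fun j _ => Real.rpow_nonneg (hρ.nonneg _) _]
        refine Finset.prod_congr rfl fun j _ => ?_
        rw [ENNReal.ofReal_rpow_of_nonneg (hρ.nonneg _) (hα j).le]
    _ ≤ _ := by
        refine Finset.prod_le_prod' fun j _ => ENNReal.rpow_le_rpow ?_ (hα j).le
        exact le_iSup₂ (f := fun A (_ : A ∈ Φ j) => ENNReal.ofReal (ρ A)) (A j) (hA j)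

theorem IsMonotoneSeminorm.supOver_le_supOver_hadamardMeanSet [SigmaFinite μ]
    (hρ : IsMonotoneSeminorm μ ρ) (hα : ∀ j, 0 < α j) (hsum : ∑ j, α j = 1)
    (Φ' : Set (L →L[ℂ] L)) (Φ : Fin m → Set (L →L[ℂ] L))
    (h : ∀ T ∈ Φ', ∃ A : Fin m → L →L[ℂ] L, (∀ j, A j ∈ Φ j) ∧ MeanDominated μ α T A) :
    supOver ρ Φ' ≤ supOver ρ (hadamardMeanSet μ α Φ) := by
  refine iSup₂_le fun T hT => ?_
  obtain ⟨A, hA, hm⟩ := h T hT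
  obtain ⟨S, hS, hle⟩ := hm.exists_isHadamardMean hα hsum
  refine (ENNReal.ofReal_le_ofReal (hρ.mono _ _ hle)).trans ?_
  exact le_iSup₂ (f := fun A (_ : A ∈ hadamardMeanSet μ α Φ) => ENNReal.ofReal (ρ A)) S ⟨A, hA, hS⟩

theorem IsMonotoneSeminorm.productInequalities [SigmaFinite μ] (hρ : IsMonotoneSeminorm μ ρ)
    (hα : ∀ j, 0 < α j) (hsum : ∑ j, α j = 1) {k : ℕ} (hk : 1 ≤ k)
    (Ψ : Fin k → Fin m → Set (L →L[ℂ] L)) : ProductInequalities μ α Ψ ρ := by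
  obtain ⟨k, rfl⟩ := Nat.exists_eq_succ_of_ne_zero (Nat.one_le_iff_ne_zero.1 hk)
  exact ⟨hρ.supOver_le_supOver_hadamardMeanSet hα hsum _ _
    (exists_meanDominated_of_mem_prod hα hsum Ψ), hρ.supOver_hadamardMeanSet_le hα hsum _⟩

theorem IsMonotoneSeminorm.sumInequalities [SigmaFinite μ] (hρ : IsMonotoneSeminorm μ ρ)
    (hα : ∀ j, 0 < α j) (hsum : ∑ j, α j = 1) {k : ℕ}
    (Ψ : Fin k → Fin m → Set (L →L[ℂ] L)) : SumInequalities μ α Ψ ρ :=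
  ⟨hρ.supOver_le_supOver_hadamardMeanSet hα hsum _ _
    (exists_meanDominated_of_mem_sum hα hsum Ψ), hρ.supOver_hadamardMeanSet_le hα hsum _⟩

end Seminorm

/-! ### The operator norm and the numerical radius -/

section Norm

variable {X : Type*} [MeasurableSpace X] {μ : Measure X} [SigmaFinite μ] {L : Type*}
  [NormedAddCommGroup L] [NormedSpace ℂ L] [CompleteSpace L] [BanachFunctionSpace μ L]

theorem KernelLE.norm_val_le {T S : L →L[ℂ] L} (h : KernelLE μ T S) (f : L) :
    ∀ᵐ x ∂μ, ‖val μ (T f) x‖ ≤ ‖val μ (S (modulus μ f)) x‖ := by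
  obtain ⟨t, s, ht, hs, hle⟩ := h
  filter_upwards [ht.enorm_val_le f, hs.enorm_val_modulus f,
    Measure.ae_ae_of_ae_prod hle] with x h1 h2 h3
  rw [← enorm_le_iff_norm_le, h2]
  refine h1.trans (lintegral_mono_ae ?_)
  filter_upwards [h3] with y hy
  gcongr

theorem isMonotoneSeminorm_norm : IsMonotoneSeminorm μ (fun A : L →L[ℂ] L => ‖A‖) where
  nonneg A := norm_nonneg A
  add_le A B := norm_add_le A B
  smul_le c A := by rw [norm_smul, Complex.norm_real, NNReal.norm_eq]
  mono T S h := by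
    refine T.opNorm_le_bound (norm_nonneg _) fun f => ?_
    rw [← norm_modulus μ f]
    exact (norm_le_of_val_ae_le μ (h.norm_val_le f)).trans (S.le_opNorm _)

end Norm

section NumericalRadius

variable {H : Type*} [NormedAddCommGroup H] [InnerProductSpace ℂ H]

theorem norm_inner_le_numericalRadius (T : H →L[ℂ] H) {f : H} (hf : ‖f‖ = 1) :
    ‖inner ℂ f (T f)‖ ≤ numericalRadius T := by
  refine le_csSup ⟨‖T‖, ?_⟩ ⟨f, hf, rfl⟩
  rintro _ ⟨g, hg, rfl⟩
  refine (norm_inner_le_norm _ _).trans ?_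
  rw [hg, one_mul]
  exact T.le_of_opNorm_le_of_le le_rfl hg.le |>.trans_eq (mul_one _)

theorem numericalRadius_nonneg (T : H →L[ℂ] H) : 0 ≤ numericalRadius T :=
  Real.sSup_nonneg (by rintro _ ⟨g, -, rfl⟩; exact norm_nonneg _)

theorem numericalRadius_le {T : H →L[ℂ] H} {r : ℝ} (hr : 0 ≤ r)
    (h : ∀ f, ‖f‖ = 1 → ‖inner ℂ f (T f)‖ ≤ r) : numericalRadius T ≤ r :=
  Real.sSup_le (by rintro _ ⟨g, hg, rfl⟩; exact h g hg) hr

variable {X : Type*} [MeasurableSpace X] {μ : Measure X} [SigmaFinite μ]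

theorem KernelLE.norm_inner_le {T S : Lp ℂ 2 μ →L[ℂ] Lp ℂ 2 μ} (h : KernelLE μ T S)
    (f : Lp ℂ 2 μ) :
    ‖inner ℂ f (T f)‖ ≤ ‖inner ℂ (modulus μ f) (S (modulus μ f))‖ := by
  have hs : ∀ᵐ x ∂μ, val μ (S (modulus μ f)) x = (‖val μ (S (modulus μ f)) x‖ : ℂ) := by
    obtain ⟨t, s, -, hs, -⟩ := h
    filter_upwards [hs.val_modulus_eq f] with x hx
    rw [hx.2, Complex.norm_real, Real.norm_of_nonneg ENNReal.toReal_nonneg]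
  rw [L2.inner_def, L2.inner_def]
  have e : ∫ x, inner ℂ (modulus μ f x) (S (modulus μ f) x) ∂μ =
      ((∫ x, ‖val μ f x‖ * ‖val μ (S (modulus μ f)) x‖ ∂μ : ℝ) : ℂ) := by
    rw [← integral_complex_ofReal]
    refine integral_congr_ae ?_
    filter_upwards [hs, val_modulus μ f] with x h1 h2
    change inner ℂ (val μ (modulus μ f) x) (val μ (S (modulus μ f)) x) = _
    rw [h2, RCLike.inner_apply, Complex.conj_ofReal]
    nth_rw 1 [h1]
    push_cast
    ring
  rw [e, Complex.norm_real, Real.norm_of_nonneg (integral_nonneg fun x => by positivity)]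
  refine norm_integral_le_of_norm_le ?_ ?_
  · have := (L2.integrable_inner (𝕜 := ℂ) (modulus μ f) (S (modulus μ f))).norm
    refine this.congr ?_
    filter_upwards [val_modulus μ f] with x h2
    change ‖inner ℂ (val μ (modulus μ f) x) (val μ (S (modulus μ f)) x)‖ = _
    rw [h2, RCLike.inner_apply, norm_mul, mul_comm]
    simp
  · filter_upwards [h.norm_val_le f] with x hx
    refine (norm_inner_le_norm _ _).trans ?_
    exact mul_le_mul_of_nonneg_left hx (norm_nonneg _)

theorem isMonotoneSeminorm_numericalRadius :
    IsMonotoneSeminorm μ (numericalRadius : (Lp ℂ 2 μ →L[ℂ] Lp ℂ 2 μ) → ℝ) where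
  nonneg A := numericalRadius_nonneg A
  add_le A B := by
    refine numericalRadius_le (add_nonneg (numericalRadius_nonneg A) (numericalRadius_nonneg B))
      fun f hf => ?_
    rw [add_apply, inner_add_right]
    exact (norm_add_le _ _).trans (add_le_add (norm_inner_le_numericalRadius A hf)
      (norm_inner_le_numericalRadius B hf))
  smul_le c A := by
    refine numericalRadius_le (mul_nonneg c.2 (numericalRadius_nonneg A)) fun f hf => ?_
    rw [smul_apply, inner_smul_right, norm_mul, Complex.norm_real, NNReal.norm_eq]
    exact mul_le_mul_of_nonneg_left (norm_inner_le_numericalRadius A hf) c.2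
  mono T S h := by
    refine numericalRadius_le (numericalRadius_nonneg S) fun f hf => ?_
    refine (h.norm_inner_le f).trans (norm_inner_le_numericalRadius S ?_)
    rw [norm_modulus, hf]

end NumericalRadius

/-! ### Order continuity and dominated convergence -/

section OrderContinuity

variable {X : Type*} [MeasurableSpace X] {μ : Measure X} {L : Type*}
  [NormedAddCommGroup L] [NormedSpace ℂ L] [CompleteSpace L] [BanachFunctionSpace μ L]

/-- Dominated convergence to `0` in a space with order continuous norm: the decreasing sequence
`sup_{k ≥ n} |h k|` lies in `L`, dominates `h n`, and has infimum `0`. -/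
theorem HasOrderContinuousNorm.tendsto_norm_zero (hL : HasOrderContinuousNorm μ L) {h : ℕ → L}
    (u : L) (hle : ∀ n, ∀ᵐ x ∂μ, ‖val μ (h n) x‖ ≤ ‖val μ u x‖)
    (hlim : ∀ᵐ x ∂μ, Tendsto (fun n => val μ (h n) x) atTop (𝓝 0)) :
    Tendsto (fun n => ‖h n‖) atTop (𝓝 0) := by
  let s : ℕ → X → ℝ≥0∞ := fun n x => ⨆ i, ‖val μ (h (i + n)) x‖ₑ
  have hsm : ∀ n, AEMeasurable (s n) μ := fun n =>
    AEMeasurable.iSup fun i => (aestronglyMeasurable_val μ _).enorm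
  have hsu : ∀ᵐ x ∂μ, ∀ n, s n x ≤ ‖val μ u x‖ₑ := by
    filter_upwards [ae_all_iff.2 hle] with x hx n
    exact iSup_le fun i => enorm_le_iff_norm_le.2 (hx _)
  have hsanti : ∀ x, Antitone fun n => s n x := by
    intro x a b hab
    refine iSup_le fun i => ?_
    have e : i + b = (i + (b - a)) + a := by omega
    rw [e]
    exact le_iSup (fun j => ‖val μ (h (j + a)) x‖ₑ) (i + (b - a))
  have hslim : ∀ᵐ x ∂μ, Tendsto (fun n => (s n x).toReal) atTop (𝓝 0) := by
    filter_upwards [hlim] with x hx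
    have h1 : Tendsto (fun n => ‖val μ (h n) x‖ₑ) atTop (𝓝 0) := by
      have := (continuous_enorm.tendsto (0 : ℂ)).comp hx
      simpa [Function.comp_def] using this
    have h2 : ⨅ n, s n x = 0 := by
      rw [← h1.limsup_eq, limsup_eq_iInf_iSup_of_nat']
    have h3 := tendsto_atTop_iInf (hsanti x)
    rw [h2] at h3
    exact (ENNReal.tendsto_toReal ENNReal.zero_ne_top).comp h3
  have hex : ∀ n, ∃ F : L, val μ F =ᵐ[μ] fun x => ((s n x).toReal : ℂ) := fun n => by
    refine exists_val_ae_eq μ u ?_ ?_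
    · exact (Complex.measurable_ofReal.comp_aemeasurable
        (hsm n).ennreal_toReal).aestronglyMeasurable
    · filter_upwards [hsu] with x hx
      rw [Complex.norm_real, Real.norm_of_nonneg ENNReal.toReal_nonneg, ← toReal_enorm]
      exact ENNReal.toReal_mono enorm_ne_top (hx n)
  choose F hF using hex
  have hFall : ∀ᵐ x ∂μ, ∀ n, val μ (F n) x = ((s n x).toReal : ℂ) := ae_all_iff.2 hF
  have h0 := AEEqFun.coeFn_zero (μ := μ) (α := X) (β := ℂ)
  have hFlim := hL F (fun a b hab => by
      rw [← AEEqFun.coeFn_le]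
      filter_upwards [hFall, hsu] with x hx hu
      change val μ (F b) x ≤ val μ (F a) x
      rw [hx, hx, Complex.real_le_real]
      exact ENNReal.toReal_mono (ne_top_of_le_ne_top enorm_ne_top (hu a)) (hsanti x hab)) (by
      constructor
      · rintro _ ⟨n, rfl⟩
        rw [← AEEqFun.coeFn_le]
        filter_upwards [hF n, h0] with x hx hx0
        rw [hx0]
        change 0 ≤ val μ (F n) x
        rw [hx]
        exact_mod_cast ENNReal.toReal_nonneg
      · intro l hl
        have h1 : ∀ n, ∀ᵐ x ∂μ, l x ≤ val μ (F n) x := fun n =>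
          AEEqFun.coeFn_le.2 (hl ⟨n, rfl⟩)
        rw [← AEEqFun.coeFn_le]
        filter_upwards [ae_all_iff.2 h1, hFall, hslim, h0] with x h1 h2 h3 h4
        rw [h4]
        have h5 : Tendsto (fun n => val μ (F n) x) atTop (𝓝 0) := by
          simp only [h2]
          have := (Complex.continuous_ofReal.tendsto 0).comp h3
          simpa [Function.comp_def] using this
        exact ge_of_tendsto' h5 h1)
  refine squeeze_zero (fun n => norm_nonneg _) (fun n => ?_) hFlim
  refine norm_le_of_val_ae_le μ ?_
  filter_upwards [hF n, hsu] with x hx hu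
  rw [hx, Complex.norm_real, Real.norm_of_nonneg ENNReal.toReal_nonneg, ← toReal_enorm]
  refine ENNReal.toReal_mono (ne_top_of_le_ne_top enorm_ne_top (hu n)) ?_
  simpa using le_iSup (fun i => ‖val μ (h (i + n)) x‖ₑ) 0

theorem HasOrderContinuousNorm.tendsto (hL : HasOrderContinuousNorm μ L) {h : ℕ → L} {g : L}
    (u : L) (hle : ∀ n, ∀ᵐ x ∂μ, ‖val μ (h n) x‖ ≤ ‖val μ u x‖)
    (hlim : ∀ᵐ x ∂μ, Tendsto (fun n => val μ (h n) x) atTop (𝓝 (val μ g x))) :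
    Tendsto h atTop (𝓝 g) := by
  rw [tendsto_iff_norm_sub_tendsto_zero]
  refine hL.tendsto_norm_zero (modulus μ u + modulus μ u) (fun n => ?_) ?_
  · filter_upwards [val_sub μ (h n) g, val_add μ (modulus μ u) (modulus μ u), val_modulus μ u,
      ae_all_iff.2 hle, hlim] with x h1 h2 h3 h4 h5
    have h6 : ‖val μ g x‖ ≤ ‖val μ u x‖ := le_of_tendsto' h5.norm h4
    rw [h1, h2, h3, ← Complex.ofReal_add, Complex.norm_real,
      Real.norm_of_nonneg (by positivity)]
    exact (norm_sub_le _ _).trans (add_le_add (h4 n) h6)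
  · filter_upwards [ae_all_iff.2 fun n => val_sub μ (h n) g, hlim] with x h1 h2
    simp only [h1]
    simpa using h2.sub_const (val μ g x)

theorem ae_lt_top_of_lintegral_mul_le [SigmaFinite μ] {v : X → ℝ≥0∞} (hv : AEMeasurable v μ)
    {C : ℝ≥0} (hC : ∀ f : L, ∫⁻ y, v y * ‖val μ f y‖ₑ ∂μ ≤ C * ‖f‖ₑ) : ∀ᵐ x ∂μ, v x < ∞ := by
  obtain ⟨e, he⟩ := exists_val_pos μ L
  have h1 : ∫⁻ y, v y * ‖val μ e y‖ₑ ∂μ ≠ ∞ :=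
    ne_top_of_le_ne_top (ENNReal.mul_ne_top ENNReal.coe_ne_top enorm_ne_top) (hC e)
  filter_upwards [ae_lt_top' (hv.mul (aestronglyMeasurable_val μ e).enorm) h1, he] with x hx hex
  refine lt_top_iff_ne_top.2 fun h3 => ?_
  rw [Pi.mul_apply, h3, ENNReal.top_mul (by simpa using hex.ne')] at hx
  exact lt_irrefl _ hx

/-- A function in the associate space of `L`, that is, with `∫ v |f| ≤ C ‖f‖` on `L`, is the density
of an element of the dual space. -/
theorem exists_dual_of_lintegral_mul_le {v : X → ℝ≥0∞} (hv : AEMeasurable v μ)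
    {C : ℝ≥0} (hC : ∀ f : L, ∫⁻ y, v y * ‖val μ f y‖ₑ ∂μ ≤ C * ‖f‖ₑ) :
    ∃ φ : StrongDual ℂ L, ∀ f, Integrable (fun y => ((v y).toReal : ℂ) * val μ f y) μ ∧
      φ f = ∫ y, ((v y).toReal : ℂ) * val μ f y ∂μ := by
  have hle : ∀ f : L, ∫⁻ y, ‖((v y).toReal : ℂ) * val μ f y‖ₑ ∂μ ≤ C * ‖f‖ₑ := fun f => by
    refine (lintegral_mono fun y => ?_).trans (hC f)
    rw [enorm_mul, ← ofReal_norm, Complex.norm_real, Real.norm_of_nonneg ENNReal.toReal_nonneg]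
    gcongr
    exact ENNReal.ofReal_toReal_le
  have hi : ∀ f : L, Integrable (fun y => ((v y).toReal : ℂ) * val μ f y) μ := fun f => by
    refine ⟨AEStronglyMeasurable.mul ?_ (aestronglyMeasurable_val μ f), ?_⟩
    · exact (Complex.measurable_ofReal.comp_aemeasurable hv.ennreal_toReal).aestronglyMeasurable
    · exact lt_of_le_of_lt (hle f) (ENNReal.mul_lt_top ENNReal.coe_lt_top enorm_lt_top)
  let φ : L →ₗ[ℂ] ℂ :=
    { toFun := fun f => ∫ y, ((v y).toReal : ℂ) * val μ f y ∂μ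
      map_add' := fun f g => by
        rw [← integral_add (hi f) (hi g)]
        refine integral_congr_ae ?_
        filter_upwards [val_add μ f g] with y hy
        rw [hy, mul_add]
      map_smul' := fun c f => by
        rw [RingHom.id_apply, smul_eq_mul, ← integral_const_mul]
        refine integral_congr_ae ?_
        filter_upwards [val_smul μ c f] with y hy
        rw [hy, mul_left_comm] }
  refine ⟨φ.mkContinuous C fun f => ?_, fun f => ⟨hi f, rfl⟩⟩
  have h1 : ‖φ f‖ₑ ≤ C * ‖f‖ₑ := (enorm_integral_le_lintegral_enorm _).trans (hle f)
  have h2 := ENNReal.toReal_mono (ENNReal.mul_ne_top ENNReal.coe_ne_top enorm_ne_top) h1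
  simpa using h2

/-- Order continuity of the dual norm, for functionals with a density: if the densities decrease to
`0`, then the functionals tend to `0` in norm. -/
theorem DualHasOrderContinuousNorm.exists_bound [SigmaFinite μ]
    (hL : DualHasOrderContinuousNorm μ L)
    {v : ℕ → X → ℝ≥0∞} (hv : ∀ n, AEMeasurable (v n) μ) (hanti : ∀ᵐ x ∂μ, Antitone fun n => v n x)
    (hlim : ∀ᵐ x ∂μ, v 0 x ≠ ∞ → Tendsto (fun n => v n x) atTop (𝓝 0))
    {C : ℝ≥0} (hC : ∀ f : L, ∫⁻ y, v 0 y * ‖val μ f y‖ₑ ∂μ ≤ C * ‖f‖ₑ) :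
    ∃ c : ℕ → ℝ≥0, Tendsto c atTop (𝓝 0) ∧
      ∀ n (f : L), ∫⁻ y, v n y * ‖val μ f y‖ₑ ∂μ ≤ c n * ‖f‖ₑ := by
  have hCn : ∀ n (f : L), ∫⁻ y, v n y * ‖val μ f y‖ₑ ∂μ ≤ C * ‖f‖ₑ := fun n f => by
    refine (lintegral_mono_ae ?_).trans (hC f)
    filter_upwards [hanti] with y hy
    gcongr
    exact hy (Nat.zero_le n)
  choose φ hφ using fun n => exists_dual_of_lintegral_mul_le (hv n) (hCn n)
  have hfin : ∀ᵐ x ∂μ, v 0 x < ∞ := ae_lt_top_of_lintegral_mul_le (hv 0) hC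
  have hreal : ∀ᵐ x ∂μ, (Antitone fun n => (v n x).toReal) ∧
      Tendsto (fun n => (v n x).toReal) atTop (𝓝 0) ∧ ∀ n, v n x ≠ ∞ := by
    filter_upwards [hfin, hanti, hlim] with x h1 h2 h3
    refine ⟨fun a b hab => ENNReal.toReal_mono ?_ (h2 hab), ?_, fun n => ?_⟩
    · exact ne_top_of_le_ne_top h1.ne (h2 (Nat.zero_le a))
    · exact (ENNReal.tendsto_toReal ENNReal.zero_ne_top).comp (h3 h1.ne)
    · exact ne_top_of_le_ne_top h1.ne (h2 (Nat.zero_le n))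
  have hnn : ∀ f : L, IsNonnegFun μ f → ∀ᵐ x ∂μ, 0 ≤ val μ f x := fun f hf => by
    filter_upwards [AEEqFun.coeFn_le.2 hf, AEEqFun.coeFn_zero (μ := μ) (α := X) (β := ℂ)]
      with x h1 h2
    rw [h2] at h1
    exact h1
  have hφlim := hL φ (fun n l hnl f hf => by
      rw [sub_apply, (hφ n f).2, (hφ l f).2, ← integral_sub (hφ n f).1 (hφ l f).1]
      refine integral_nonneg_of_ae ?_
      filter_upwards [hreal, hnn f hf] with x h1 h2
      rw [← sub_mul]
      refine mul_nonneg ?_ h2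
      rw [← Complex.ofReal_sub]
      exact_mod_cast sub_nonneg.2 (h1.1 hnl)) (fun n f hf => by
      rw [sub_zero, (hφ n f).2]
      refine integral_nonneg_of_ae ?_
      filter_upwards [hnn f hf] with x h2
      exact mul_nonneg (by exact_mod_cast ENNReal.toReal_nonneg) h2) (fun ψ hψ f hf => by
      have h1 : Tendsto (fun n => φ n f) atTop (𝓝 (∫ _, (0 : ℂ) ∂μ)) := by
        simp only [(hφ _ f).2]
        refine tendsto_integral_of_dominated_convergence _ (fun n => (hφ n f).1.1)
          (hφ 0 f).1.norm (fun n => ?_) ?_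
        · filter_upwards [hreal] with x hx
          rw [norm_mul, norm_mul, Complex.norm_real, Complex.norm_real,
            Real.norm_of_nonneg ENNReal.toReal_nonneg, Real.norm_of_nonneg ENNReal.toReal_nonneg]
          exact mul_le_mul_of_nonneg_right (hx.1 (Nat.zero_le n)) (norm_nonneg _)
        · filter_upwards [hreal] with x hx
          have := ((Complex.continuous_ofReal.tendsto 0).comp hx.2.1).mul_const (val μ f x)
          simpa using this
      rw [integral_zero] at h1
      have h2 := h1.sub_const (ψ f)
      rw [zero_sub] at h2
      rw [zero_sub, neg_apply]
      exact ge_of_tendsto' h2 fun n => hψ n f hf)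
  refine ⟨fun n => ‖φ n‖₊, ?_, fun n f => ?_⟩
  · rw [← NNReal.tendsto_coe]
    simpa using hφlim
  · have h1 : ∫⁻ y, v n y * ‖val μ f y‖ₑ ∂μ = ‖φ n (modulus μ f)‖ₑ := by
      rw [(hφ n _).2]
      have e : (fun y => ((v n y).toReal : ℂ) * val μ (modulus μ f) y) =ᵐ[μ]
          fun y => (((v n y).toReal * ‖val μ f y‖ : ℝ) : ℂ) := by
        filter_upwards [val_modulus μ f] with y hy
        rw [hy]; push_cast; rfl
      rw [integral_congr_ae e, integral_complex_ofReal, ← ofReal_norm, Complex.norm_real,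
        Real.norm_of_nonneg (integral_nonneg fun y => by positivity),
        ofReal_integral_eq_lintegral_ofReal]
      · refine lintegral_congr_ae ?_
        filter_upwards [hreal] with y hy
        rw [ENNReal.ofReal_mul ENNReal.toReal_nonneg, ENNReal.ofReal_toReal (hy.2.2 n),
          ofReal_norm]
      · have := ((hφ n (modulus μ f)).1.congr e).re
        simpa using this
      · exact ae_of_all _ fun y => by positivity
    rw [h1]
    calc ‖φ n (modulus μ f)‖ₑ ≤ ‖φ n‖ₑ * ‖modulus μ f‖ₑ := (φ n).le_opENorm _
      _ = _ := by rw [← ofReal_norm (modulus μ f), norm_modulus, ofReal_norm]; rfl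

end OrderContinuity

/-! ### A strictly positive functional -/

section Weight

variable {X : Type*} [MeasurableSpace X] {μ : Measure X} {L : Type*}
  [NormedAddCommGroup L] [NormedSpace ℂ L] [CompleteSpace L] [BanachFunctionSpace μ L]

/-- The pointwise retraction of `ℂ` onto the disc of radius `r`. -/
noncomputable def trunc (r : ℝ) (z : ℂ) : ℂ := ((r / max r ‖z‖ : ℝ) : ℂ) * z

theorem continuous_trunc {r : ℝ} (hr : 0 ≤ r) : Continuous (trunc r) := by
  unfold trunc
  rcases hr.eq_or_lt with rfl | hr
  · simpa using continuous_const
  · refine Continuous.mul (Complex.continuous_ofReal.comp ?_) continuous_id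
    exact continuous_const.div (continuous_const.max continuous_norm)
      fun z => (lt_max_of_lt_left hr).ne'

theorem norm_trunc {r : ℝ} (hr : 0 ≤ r) (z : ℂ) : ‖trunc r z‖ = r / max r ‖z‖ * ‖z‖ := by
  rw [trunc, norm_mul, Complex.norm_real, Real.norm_of_nonneg (by positivity)]

theorem norm_trunc_le_radius {r : ℝ} (hr : 0 ≤ r) (z : ℂ) : ‖trunc r z‖ ≤ r := by
  rw [norm_trunc hr, div_mul_eq_mul_div]
  refine div_le_of_le_mul₀ (by positivity) hr ?_
  exact mul_le_mul_of_nonneg_left (le_max_right _ _) hr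

theorem norm_trunc_le {r : ℝ} (hr : 0 ≤ r) (z : ℂ) : ‖trunc r z‖ ≤ ‖z‖ := by
  rw [norm_trunc hr]
  exact mul_le_of_le_one_left (norm_nonneg _) (div_le_one_of_le₀ (le_max_left _ _) (by positivity))

theorem trunc_of_norm_le {r : ℝ} {z : ℂ} (h : ‖z‖ ≤ r) : trunc r z = z := by
  rw [trunc, max_eq_left h]
  rcases eq_or_ne r 0 with rfl | hr
  · have : z = 0 := by simpa using h
    simp [this]
  · simp [hr]

theorem norm_sub_trunc_le {r s : ℝ} (hs : 0 ≤ s) {z : ℂ} (h : ‖z‖ ≤ r + s) :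
    ‖z - trunc r z‖ ≤ s := by
  rcases le_total ‖z‖ r with h1 | h1
  · rw [trunc_of_norm_le h1, sub_self, norm_zero]; exact hs
  · have e : z - trunc r z = ((1 - r / ‖z‖ : ℝ) : ℂ) * z := by
      rw [trunc, max_eq_right h1]; push_cast; ring
    rcases (norm_nonneg z).eq_or_lt with h0 | h0
    · have : z = 0 := by simpa using h0.symm
      subst this
      simpa [trunc] using hs
    · rw [e, norm_mul, Complex.norm_real, Real.norm_of_nonneg
        (sub_nonneg.2 (div_le_one_of_le₀ h1 h0.le)), sub_mul, div_mul_cancel₀ _ h0.ne']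
      linarith

variable (μ) in
theorem exists_val_eq_trunc (u f : L) :
    ∃ g : L, val μ g =ᵐ[μ] fun x => trunc ‖val μ u x‖ (val μ f x) := by
  refine exists_val_ae_eq μ f ?_ (ae_of_all _ fun _ => norm_trunc_le (norm_nonneg _) _)
  have hu := (aestronglyMeasurable_val μ u).norm.aemeasurable
  have hf := (aestronglyMeasurable_val μ f).aemeasurable
  refine AEMeasurable.aestronglyMeasurable ?_
  exact (Complex.measurable_ofReal.comp_aemeasurable (hu.div (hu.max hf.norm))).mul hf

variable (μ) in
theorem exists_val_eq_indicator (f : L) {A : Set X} (hA : MeasurableSet A) :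
    ∃ g : L, val μ g =ᵐ[μ] A.indicator (val μ f) :=
  exists_val_ae_eq μ f ((aestronglyMeasurable_val μ f).indicator hA)
    (ae_of_all _ fun _ => norm_indicator_le_norm_self _ _)

theorem exists_memLp_two_indicator [SigmaFinite μ] {f : X → ℂ} (hf : Measurable f) :
    ∃ A : ℕ → Set X, (∀ n, MeasurableSet (A n)) ∧ Monotone A ∧ ⋃ n, A n = Set.univ ∧
      ∀ n, MemLp ((A n).indicator f) 2 μ := by
  have hm : ∀ n : ℕ, MeasurableSet ({x | ‖f x‖ ≤ n} ∩ spanningSets μ n) := fun n =>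
    (measurableSet_le hf.norm measurable_const).inter (measurableSet_spanningSets μ n)
  refine ⟨fun n => {x | ‖f x‖ ≤ n} ∩ spanningSets μ n, hm, fun a b hab x hx => ?_, ?_,
    fun n => ?_⟩
  · have h : ‖f x‖ ≤ a := hx.1
    exact ⟨le_trans h (Nat.cast_le.2 hab), monotone_spanningSets μ hab hx.2⟩
  · refine Set.eq_univ_of_forall fun x => Set.mem_iUnion.2 ?_
    obtain ⟨a, ha⟩ := exists_nat_ge ‖f x‖
    obtain ⟨b, hb⟩ := Set.mem_iUnion.1 ((iUnion_spanningSets μ).symm ▸ Set.mem_univ x)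
    refine ⟨max a b, ha.trans (Nat.cast_le.2 (le_max_left a b)), ?_⟩
    exact monotone_spanningSets μ (le_max_right a b) hb
  · have hfin : μ ({x | ‖f x‖ ≤ n} ∩ spanningSets μ n) ≠ ∞ :=
      ((measure_mono Set.inter_subset_right).trans_lt (measure_spanningSets_lt_top μ n)).ne
    refine (memLp_indicator_const 2 (hm n) (n : ℝ) (Or.inr hfin)).mono
      (hf.indicator (hm n)).aestronglyMeasurable (ae_of_all _ fun x => ?_)
    by_cases hx : x ∈ {x | ‖f x‖ ≤ n} ∩ spanningSets μ n
    · rw [Set.indicator_of_mem hx, Set.indicator_of_mem hx]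
      exact hx.1.trans (le_abs_self _)
    · rw [Set.indicator_of_notMem hx, Set.indicator_of_notMem hx]
      simp

/-- If the norm of `L` is order continuous, then every `g ≥ 0` in `L ∩ L²` that is not `0` is
charged by some `w` in the associate space of `L`. The unit ball of `L ∩ L²` is convex and, by
order continuity, its closure in `L²` does not contain `2 g / ‖g‖`; a functional separating the two
gives `w`. -/
theorem exists_density_of_memLp_two (hL : HasOrderContinuousNorm μ L) [SigmaFinite μ] {g : L}
    (hg : MemLp (val μ g) 2 μ) (hg0 : g ≠ 0) :
    ∃ w : X → ℝ≥0∞, Measurable w ∧ (∀ f : L, ∫⁻ x, w x * ‖val μ f x‖ₑ ∂μ ≤ ‖f‖ₑ) ∧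
      ¬ ∀ᵐ x ∂μ, val μ g x ≠ 0 → w x = 0 := by
  let V : Set (Lp ℂ 2 μ) := {h | ∃ f : L, ‖f‖ ≤ 1 ∧ val μ f =ᵐ[μ] h}
  have hVconv : Convex ℝ V := by
    rintro h₁ ⟨f₁, hf₁, e₁⟩ h₂ ⟨f₂, hf₂, e₂⟩ a b ha hb hab
    refine ⟨(a : ℂ) • f₁ + (b : ℂ) • f₂, ?_, ?_⟩
    · refine (norm_add_le _ _).trans ?_
      rw [norm_smul, norm_smul, Complex.norm_real, Complex.norm_real, Real.norm_of_nonneg ha,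
        Real.norm_of_nonneg hb, ← hab]
      gcongr <;> exact mul_le_of_le_one_right ‹_› ‹_›
    · filter_upwards [e₁, e₂, val_add μ ((a : ℂ) • f₁) ((b : ℂ) • f₂), val_smul μ a f₁,
        val_smul μ b f₂, Lp.coeFn_add (a • h₁) (b • h₂), Lp.coeFn_smul a h₁, Lp.coeFn_smul b h₂]
        with x h1 h2 h3 h4 h5 h6 h7 h8
      rw [h3, h6, h4, h5, Pi.add_apply, h7, h8, h1, h2]
      simp
  let c : ℝ := 2 / ‖g‖
  have hgn : 0 < ‖g‖ := norm_pos_iff.2 hg0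
  let G : Lp ℂ 2 μ := (c : ℂ) • hg.toLp _
  have hGae : (G : X → ℂ) =ᵐ[μ] val μ ((c : ℂ) • g) := by
    filter_upwards [Lp.coeFn_smul (c : ℂ) (hg.toLp _), hg.coeFn_toLp, val_smul μ c g]
      with x h1 h2 h3
    rw [h1, h3, Pi.smul_apply, h2, smul_eq_mul]
  have hGV : G ∉ closure V := by
    intro hG
    obtain ⟨h, hV, hlim⟩ := mem_closure_iff_seq_limit.1 hG
    choose f hf1 hfh using hV
    obtain ⟨ns, -, hns⟩ := (tendstoInMeasure_of_tendsto_Lp hlim).exists_seq_tendsto_ae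
    choose F hF using fun n => exists_val_eq_trunc μ ((c : ℂ) • g) (f (ns n))
    have h1 : Tendsto F atTop (𝓝 ((c : ℂ) • g)) := by
      refine hL.tendsto ((c : ℂ) • g) (fun n => ?_) ?_
      · filter_upwards [hF n] with x hx
        rw [hx]
        exact norm_trunc_le_radius (norm_nonneg _) _
      · filter_upwards [ae_all_iff.2 hF, ae_all_iff.2 hfh, hns, hGae] with x h1 h2 h3 h4
        simp only [h1, h2]
        have h5 := ((continuous_trunc (norm_nonneg (val μ ((c : ℂ) • g) x))).tendsto _).comp h3
        rw [h4, trunc_of_norm_le le_rfl] at h5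
        exact h5
    have h2 : ‖(c : ℂ) • g‖ ≤ 1 := by
      refine le_of_tendsto' h1.norm fun n => (norm_le_of_val_ae_le μ ?_).trans (hf1 (ns n))
      filter_upwards [hF n] with x hx
      rw [hx]
      exact norm_trunc_le (norm_nonneg _) _
    rw [norm_smul, Complex.norm_real, Real.norm_of_nonneg (by positivity)] at h2
    simp only [c] at h2
    rw [div_mul_cancel₀ _ hgn.ne'] at h2
    norm_num at h2
  obtain ⟨φ, u, hφ, hu⟩ := RCLike.geometric_hahn_banach_closed_point (𝕜 := ℂ) hVconv.closure
    isClosed_closure hGV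
  have hu0 : 0 < u := by
    have := hφ 0 (subset_closure ⟨0, by simp, by
      filter_upwards [val_zero μ L, Lp.coeFn_zero ℂ 2 μ] with x h1 h2
      rw [h1, h2]; rfl⟩)
    simpa using this
  let w₀ : Lp ℂ 2 μ := (InnerProductSpace.toDual ℂ _).symm φ
  have hw₀ : ∀ h, φ h = ∫ x, h x * (starRingEnd ℂ) (w₀ x) ∂μ := fun h => by
    rw [← InnerProductSpace.toDual_symm_apply, L2.inner_def]
    rfl
  have hw₀m : Measurable (w₀ : X → ℂ) := (Lp.stronglyMeasurable w₀).measurable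
  have hball : ∀ f : L, ‖f‖ ≤ 1 → MemLp (val μ f) 2 μ →
      ∫⁻ x, ‖w₀ x‖ₑ * ‖val μ f x‖ₑ ∂μ ≤ ENNReal.ofReal u := by
    intro f hf1 hf2
    -- rotating the phase of `f` makes the integrand nonnegative
    let q : X → ℂ := fun x => (‖val μ f x‖ : ℂ) * (w₀ x * ((‖w₀ x‖⁻¹ : ℝ) : ℂ))
    have hqm : AEStronglyMeasurable q μ := by
      have h1 := (aestronglyMeasurable_val μ f).norm.aemeasurable
      refine AEMeasurable.aestronglyMeasurable ?_
      exact (Complex.measurable_ofReal.comp_aemeasurable h1).mul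
        (hw₀m.mul (Complex.measurable_ofReal.comp hw₀m.norm.inv)).aemeasurable
    have hqn : ∀ x, ‖q x‖ ≤ ‖val μ f x‖ := fun x => by
      simp only [q, norm_mul, Complex.norm_real, norm_norm, norm_inv]
      refine mul_le_of_le_one_right (norm_nonneg _) ?_
      exact mul_inv_le_one
    obtain ⟨F, hF⟩ := exists_val_ae_eq μ f hqm (ae_of_all _ hqn)
    have hq2 : MemLp q 2 μ := hf2.mono hqm (ae_of_all _ hqn)
    have hFV : hq2.toLp q ∈ V := by
      refine ⟨F, (norm_le_of_val_ae_le μ ?_).trans hf1, hF.trans hq2.coeFn_toLp.symm⟩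
      filter_upwards [hF] with x hx
      rw [hx]
      exact hqn x
    have h1 := hφ _ (subset_closure hFV)
    have e : (fun x => hq2.toLp q x * (starRingEnd ℂ) (w₀ x)) =ᵐ[μ]
        fun x => ((‖w₀ x‖ * ‖val μ f x‖ : ℝ) : ℂ) := by
      filter_upwards [hq2.coeFn_toLp] with x hx
      rw [hx]
      simp only [q]
      rcases eq_or_ne (w₀ x) 0 with h0 | h0
      · simp [h0]
      · have h3 : w₀ x * (starRingEnd ℂ) (w₀ x) = (‖w₀ x‖ : ℂ) ^ 2 := RCLike.mul_conj _
        have h4 : (‖w₀ x‖ : ℂ) ≠ 0 := by simpa using h0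
        push_cast
        calc _ = (‖val μ f x‖ : ℂ) * (w₀ x * (starRingEnd ℂ) (w₀ x)) * (‖w₀ x‖ : ℂ)⁻¹ := by ring
          _ = _ := by rw [h3]; field_simp
    rw [hw₀, integral_congr_ae e, integral_complex_ofReal] at h1
    have hi : Integrable (fun x => ‖w₀ x‖ * ‖val μ f x‖) μ :=
      (Lp.memLp w₀).norm.integrable_mul hf2.norm
    have h2 : ∫⁻ x, ‖w₀ x‖ₑ * ‖val μ f x‖ₑ ∂μ = ENNReal.ofReal (∫ x, ‖w₀ x‖ * ‖val μ f x‖ ∂μ) := by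
      rw [ofReal_integral_eq_lintegral_ofReal hi (ae_of_all _ fun x => by positivity)]
      refine lintegral_congr fun x => ?_
      rw [ENNReal.ofReal_mul (norm_nonneg _), ofReal_norm, ofReal_norm]
    rw [h2]
    exact ENNReal.ofReal_le_ofReal h1.le
  have hL2 : ∀ f : L, MemLp (val μ f) 2 μ →
      ∫⁻ x, ‖w₀ x‖ₑ * ‖val μ f x‖ₑ ∂μ ≤ ENNReal.ofReal u * ‖f‖ₑ := by
    intro f hf
    rcases eq_or_ne f 0 with rfl | hf0
    · have : ∫⁻ x, ‖w₀ x‖ₑ * ‖val μ (0 : L) x‖ₑ ∂μ = 0 := by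
        rw [← lintegral_zero (μ := μ)]
        refine lintegral_congr_ae ?_
        filter_upwards [val_zero μ L] with x hx
        simp [hx]
      rw [this]
      exact zero_le
    · have hfn : (‖f‖ : ℂ) ≠ 0 := by simpa using hf0
      have h1 := hball ((‖f‖⁻¹ : ℂ) • f) (by
        rw [norm_smul, norm_inv, Complex.norm_real, norm_norm]
        exact inv_mul_le_one) ((hf.const_mul (‖f‖⁻¹ : ℂ)).ae_eq (val_smul μ _ f).symm)
      have h2 : ∫⁻ x, ‖w₀ x‖ₑ * ‖val μ f x‖ₑ ∂μ =
          (∫⁻ x, ‖w₀ x‖ₑ * ‖val μ ((‖f‖⁻¹ : ℂ) • f) x‖ₑ ∂μ) * ‖f‖ₑ := by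
        rw [← lintegral_mul_const' _ _ enorm_ne_top]
        refine lintegral_congr_ae ?_
        filter_upwards [val_smul μ (‖f‖⁻¹ : ℂ) f] with x hx
        have h3 : ‖(‖f‖ : ℂ)‖ₑ = ‖f‖ₑ := by
          rw [← ofReal_norm, Complex.norm_real, norm_norm, ofReal_norm]
        rw [hx, mul_assoc, ← h3, ← enorm_mul ((‖f‖⁻¹ : ℂ) * val μ f x), mul_right_comm, inv_mul_cancel₀ hfn, one_mul]
      rw [h2]
      gcongr
  have hfull : ∀ f : L, ∫⁻ x, ‖w₀ x‖ₑ * ‖val μ f x‖ₑ ∂μ ≤ ENNReal.ofReal u * ‖f‖ₑ := by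
    intro f
    obtain ⟨A, hA, hAm, hAu, hA2⟩ := exists_memLp_two_indicator (μ := μ) (f := val μ f)
      (AEEqFun.measurable _)
    rw [← setLIntegral_univ, ← hAu, setLIntegral_iUnion_of_directed _ hAm.directed_le]
    refine iSup_le fun n => ?_
    obtain ⟨F, hF⟩ := exists_val_eq_indicator μ f (hA n)
    have h1 : ‖F‖ₑ ≤ ‖f‖ₑ := enorm_le_iff_norm_le.2 (norm_le_of_val_ae_le μ (by
      filter_upwards [hF] with x hx
      rw [hx]
      exact norm_indicator_le_norm_self _ _))
    calc ∫⁻ x in A n, ‖w₀ x‖ₑ * ‖val μ f x‖ₑ ∂μ = ∫⁻ x, ‖w₀ x‖ₑ * ‖val μ F x‖ₑ ∂μ := by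
          rw [← lintegral_indicator (hA n)]
          refine lintegral_congr_ae ?_
          filter_upwards [hF] with x hx
          rw [hx]
          by_cases h : x ∈ A n <;> simp [h]
      _ ≤ ENNReal.ofReal u * ‖F‖ₑ := hL2 F ((hA2 n).ae_eq hF.symm)
      _ ≤ _ := by gcongr
  have hu0' : ENNReal.ofReal u ≠ 0 := by simpa using hu0
  refine ⟨fun x => (ENNReal.ofReal u)⁻¹ * ‖w₀ x‖ₑ, hw₀m.enorm.const_mul _, fun f => ?_,
    fun h => ?_⟩
  · simp only [mul_assoc]
    rw [lintegral_const_mul' _ _ (ENNReal.inv_ne_top.2 hu0')]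
    calc _ ≤ (ENNReal.ofReal u)⁻¹ * (ENNReal.ofReal u * ‖f‖ₑ) := by gcongr; exact hfull f
      _ = ‖f‖ₑ := by rw [← mul_assoc, ENNReal.inv_mul_cancel hu0' ENNReal.ofReal_ne_top, one_mul]
  · have h1 : φ G = 0 := by
      rw [hw₀]
      refine integral_eq_zero_of_ae ?_
      filter_upwards [h, hGae, val_smul μ c g] with x hx h2 h3
      rw [h2, h3]
      rcases eq_or_ne (val μ g x) 0 with h4 | h4
      · simp [h4]
      · have h5 := hx h4
        have h6 : w₀ x = 0 := by simpa using h5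
        simp [h6]
    rw [h1] at hu
    simp only [map_zero] at hu
    exact lt_asymm hu hu0

/-- If the norm of `L` is order continuous, then the associate space of `L` contains a function
that is positive everywhere. -/
theorem HasOrderContinuousNorm.exists_pos_density [SigmaFinite μ]
    (hL : HasOrderContinuousNorm μ L) :
    ∃ w : X → ℝ≥0, Measurable w ∧ (∀ x, 0 < w x) ∧
      ∀ f : L, ∫⁻ x, w x * ‖val μ f x‖ₑ ∂μ ≤ ‖f‖ₑ := by
  let W : Set (X → ℝ≥0∞) :=
    {w | Measurable w ∧ ∀ f : L, ∫⁻ x, w x * ‖val μ f x‖ₑ ∂μ ≤ ‖f‖ₑ}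
  obtain ⟨w, ⟨hwm, hw⟩, hmax⟩ := exists_maximal_support μ W (fun w hw => hw.1)
    ⟨fun _ => 0, measurable_const, by simp⟩ (fun w hw => by
      refine ⟨Measurable.tsum fun n => (hw n).1.const_mul _, fun f => ?_⟩
      have hf := (aestronglyMeasurable_val μ f).enorm
      simp only [← ENNReal.tsum_mul_right]
      rw [lintegral_tsum fun n => (((hw n).1.const_mul _).aemeasurable.fun_mul hf)]
      calc ∑' n, ∫⁻ x, 2⁻¹ ^ (n + 1) * w n x * ‖val μ f x‖ₑ ∂μ
          ≤ ∑' n, 2⁻¹ ^ (n + 1) * ‖f‖ₑ := by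
            refine ENNReal.tsum_le_tsum fun n => ?_
            simp only [mul_assoc]
            rw [lintegral_const_mul'' _ ((hw n).1.aemeasurable.fun_mul hf)]
            gcongr
            exact (hw n).2 f
        _ = ‖f‖ₑ := by
            rw [ENNReal.tsum_mul_right]
            simp only [pow_succ', ENNReal.tsum_mul_left, ENNReal.tsum_geometric]
            rw [ENNReal.one_sub_inv_two, inv_inv, ENNReal.inv_mul_cancel two_ne_zero
              ENNReal.ofNat_ne_top, one_mul])
  have hw0 : ∀ᵐ x ∂μ, w x ≠ 0 := by
    have hms : MeasurableSet {x | w x = 0} := hwm (measurableSet_singleton 0)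
    have hY := BanachFunctionSpace.carrier (μ := μ) (L := L) _ hms fun f => ?_
    · rw [ae_iff]
      simpa using hY
    · rw [ae_restrict_iff' hms]
      obtain ⟨A, hA, -, hAu, hA2⟩ := exists_memLp_two_indicator (μ := μ) (f := val μ f)
        (AEEqFun.measurable _)
      have h1 : ∀ n, ∀ᵐ x ∂μ, x ∈ A n → w x = 0 → val μ f x = 0 := by
        intro n
        have hms' := (hA n).inter hms
        obtain ⟨g, hg⟩ := exists_val_eq_indicator μ f hms'
        have hg2 : MemLp (val μ g) 2 μ := by
          refine (hA2 n).mono (aestronglyMeasurable_val μ g) ?_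
          filter_upwards [hg] with x hx
          rw [hx]
          exact norm_indicator_le_of_subset Set.inter_subset_left _ _
        by_cases hg0 : g = 0
        · subst hg0
          filter_upwards [hg, val_zero μ L] with x h1 h2 h3 h4
          have h5 : x ∈ A n ∩ {x | w x = 0} := ⟨h3, h4⟩
          rw [h2, Set.indicator_of_mem h5] at h1
          exact h1.symm
        · exfalso
          obtain ⟨w', hw'm, hw', hne⟩ := exists_density_of_memLp_two hL hg2 hg0
          refine hne ?_
          filter_upwards [hmax w' ⟨hw'm, hw'⟩, hg] with x h1 h2 h3
          refine h1 ?_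
          by_contra h4
          have h5 : x ∉ A n ∩ {x | w x = 0} := fun h5 => h4 h5.2
          exact h3 (h2.trans (Set.indicator_of_notMem h5 _))
      filter_upwards [ae_all_iff.2 h1] with x hx h0
      obtain ⟨n, hn⟩ := Set.mem_iUnion.1 (hAu.symm ▸ Set.mem_univ x)
      exact hx n hn h0
  have hwt : ∀ᵐ x ∂μ, w x < ∞ :=
    ae_lt_top_of_lintegral_mul_le (L := L) (C := 1) hwm.aemeasurable (by simpa using hw)
  have hms : MeasurableSet {x | w x = 0 ∨ w x = ∞} :=
    (hwm (measurableSet_singleton 0)).union (hwm (measurableSet_singleton ∞))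
  classical
  refine ⟨fun x => if w x = 0 ∨ w x = ∞ then 1 else (w x).toNNReal,
    Measurable.ite hms measurable_const hwm.ennreal_toNNReal, fun x => ?_, fun f => ?_⟩
  · by_cases h : w x = 0 ∨ w x = ∞
    · simp [h]
    · simp only [if_neg h]
      push Not at h
      exact ENNReal.toNNReal_pos h.1 h.2
  · refine le_trans (le_of_eq (lintegral_congr_ae ?_)) (hw f)
    filter_upwards [hw0, hwt] with x h1 h2
    rw [if_neg (by simp [h1, h2.ne]), ENNReal.coe_toNNReal h2.ne]

end Weight

/-! ### Kernel operators into `L¹` -/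

section L1Kernels

variable {X : Type*} [MeasurableSpace X] (μ ν : Measure X)
  (L : Type*) [NormedAddCommGroup L] [NormedSpace ℂ L] [CompleteSpace L] [BanachFunctionSpace μ L]

/-- The kernel `r` maps `L` into `L¹(ν)` with norm at most `C`: integrating it against `ν` in the
first variable gives the density of a functional on `L` of norm at most `C`. -/
def HasL1Bound (r : X → X → ℝ≥0) (C : ℝ≥0) : Prop :=
  Measurable (Function.uncurry r) ∧
    ∀ f : L, ∫⁻ y, (∫⁻ x, r x y ∂ν) * ‖val μ f y‖ₑ ∂μ ≤ C * ‖f‖ₑ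

/-- `R : L → L¹(ν)` is the operator with kernel `r`. -/
def IsL1Kernel {L : Type*} [NormedAddCommGroup L] [NormedSpace ℂ L] [CompleteSpace L]
    [BanachFunctionSpace μ L] (R : L →L[ℂ] Lp ℂ 1 ν) (r : X → X → ℝ≥0) : Prop :=
  ∀ f : L, ∀ᵐ x ∂ν, Integrable (fun y => (r x y : ℂ) * val μ f y) μ ∧
    R f x = ∫ y, (r x y : ℂ) * val μ f y ∂μ

/-- The kernel `r` defines a compact operator `L → L¹(ν)`. -/
def HasCompactL1Operator (r : X → X → ℝ≥0) : Prop :=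
  ∃ R : L →L[ℂ] Lp ℂ 1 ν, IsL1Kernel μ ν R r ∧ IsCompactOperator R

variable {μ ν L}

theorem lintegral_lintegral_kernel [SigmaFinite μ] [SigmaFinite ν]
    {r : X → X → ℝ≥0} (hr : Measurable (Function.uncurry r))
    (f : L) : ∫⁻ x, ∫⁻ y, r x y * ‖val μ f y‖ₑ ∂μ ∂ν =
      ∫⁻ y, (∫⁻ x, r x y ∂ν) * ‖val μ f y‖ₑ ∂μ := by
  rw [lintegral_lintegral_swap]
  · refine lintegral_congr fun y => ?_
    have : Measurable fun x => r x y := hr.comp measurable_prodMk_right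
    rw [lintegral_mul_const _ this.coe_nnreal_ennreal]
  · exact hr.coe_nnreal_ennreal.aemeasurable.mul (aestronglyMeasurable_val μ f).enorm.comp_snd

theorem HasL1Bound.mono {r r' : X → X → ℝ≥0} {C : ℝ≥0} (h : HasL1Bound μ ν L r C)
    (hr' : Measurable (Function.uncurry r')) (hle : ∀ x y, r' x y ≤ r x y) :
    HasL1Bound μ ν L r' C := by
  refine ⟨hr', fun f => (lintegral_mono fun y => ?_).trans (h.2 f)⟩
  gcongr
  exact hle _ _

theorem HasL1Bound.integrable [SigmaFinite μ] [SigmaFinite ν]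
    {r : X → X → ℝ≥0} {C : ℝ≥0} (h : HasL1Bound μ ν L r C) (f : L) :
    Integrable (fun p : X × X => (r p.1 p.2 : ℂ) * val μ f p.2) (ν.prod μ) := by
  have hm : AEStronglyMeasurable (fun p : X × X => (r p.1 p.2 : ℂ) * val μ f p.2) (ν.prod μ) :=
    (Complex.measurable_ofReal.comp h.1.coe_nnreal_real).aestronglyMeasurable.mul
      (aestronglyMeasurable_val μ f).comp_snd
  refine ⟨hm, ?_⟩
  rw [hasFiniteIntegral_iff_enorm, lintegral_prod _ hm.enorm]
  simp only [enorm_mul, enorm_coe_nnreal_complex]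
  rw [lintegral_lintegral_kernel h.1]
  exact (h.2 f).trans_lt (ENNReal.mul_lt_top ENNReal.coe_lt_top enorm_lt_top)

theorem IsL1Kernel.norm_le [SigmaFinite μ] [SigmaFinite ν]
    {R : L →L[ℂ] Lp ℂ 1 ν} {r : X → X → ℝ≥0} {C : ℝ≥0}
    (hR : IsL1Kernel μ ν R r) (h : HasL1Bound μ ν L r C) : ‖R‖ ≤ C := by
  refine R.opNorm_le_bound C.2 fun f => ?_
  have h1 : ‖R f‖ₑ ≤ C * ‖f‖ₑ := by
    rw [Lp.enorm_def, eLpNorm_one_eq_lintegral_enorm]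
    refine le_trans ?_ (h.2 f)
    rw [← lintegral_lintegral_kernel h.1]
    refine lintegral_mono_ae ?_
    filter_upwards [hR f] with x hx
    rw [hx.2]
    refine (enorm_integral_le_lintegral_enorm _).trans_eq ?_
    simp only [enorm_mul, enorm_coe_nnreal_complex]
  have h2 := ENNReal.toReal_mono (ENNReal.mul_ne_top ENNReal.coe_ne_top enorm_ne_top) h1
  simpa using h2

theorem HasL1Bound.exists_isL1Kernel [SigmaFinite μ] [SigmaFinite ν]
    {r : X → X → ℝ≥0} {C : ℝ≥0} (h : HasL1Bound μ ν L r C) :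
    ∃ R : L →L[ℂ] Lp ℂ 1 ν, IsL1Kernel μ ν R r := by
  have hi : ∀ f : L, Integrable (fun x => ∫ y, (r x y : ℂ) * val μ f y ∂μ) ν := fun f =>
    (h.integrable f).integral_prod_left
  have hy : ∀ f : L, ∀ᵐ x ∂ν, Integrable (fun y => (r x y : ℂ) * val μ f y) μ := fun f =>
    (h.integrable f).prod_right_ae
  let R : L →ₗ[ℂ] Lp ℂ 1 ν :=
    { toFun := fun f => (hi f).toL1 _
      map_add' := fun f g => by
        rw [← Integrable.toL1_add, Integrable.toL1_eq_toL1_iff]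
        filter_upwards [hy f, hy g] with x h1 h2
        rw [Pi.add_apply, ← integral_add h1 h2]
        refine integral_congr_ae ?_
        filter_upwards [val_add μ f g] with y hy
        rw [hy, mul_add]
      map_smul' := fun c f => by
        rw [RingHom.id_apply, ← Integrable.toL1_smul, Integrable.toL1_eq_toL1_iff]
        refine ae_of_all _ fun x => ?_
        change _ = c * _
        rw [← integral_const_mul]
        refine integral_congr_ae ?_
        filter_upwards [val_smul μ c f] with y hy
        rw [hy, mul_left_comm] }
  refine ⟨R.mkContinuous C fun f => ?_, fun f => ?_⟩
  · have h1 : ‖R f‖ₑ ≤ C * ‖f‖ₑ := by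
      refine (Integrable.enorm_toL1 (hi f)).le.trans (le_trans ?_ (h.2 f))
      rw [← lintegral_lintegral_kernel h.1]
      refine lintegral_mono fun x => ?_
      refine (enorm_integral_le_lintegral_enorm _).trans_eq ?_
      simp only [enorm_mul, enorm_coe_nnreal_complex]
    have h2 := ENNReal.toReal_mono (ENNReal.mul_ne_top ENNReal.coe_ne_top enorm_ne_top) h1
    simpa using h2
  · filter_upwards [hy f, (hi f).coeFn_toL1] with x h1 h2
    exact ⟨h1, h2⟩

theorem IsL1Kernel.sub {R R' : L →L[ℂ] Lp ℂ 1 ν} {r r' : X → X → ℝ≥0} (hR : IsL1Kernel μ ν R r)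
    (hR' : IsL1Kernel μ ν R' r') (hle : ∀ x y, r' x y ≤ r x y) :
    IsL1Kernel μ ν (R - R') (fun x y => r x y - r' x y) := by
  intro f
  filter_upwards [hR f, hR' f, Lp.coeFn_sub (R f) (R' f)] with x h1 h2 h3
  have e : (fun y => ((r x y - r' x y : ℝ≥0) : ℂ) * val μ f y) =
      fun y => (r x y : ℂ) * val μ f y - (r' x y : ℂ) * val μ f y := by
    funext y
    rw [NNReal.coe_sub (hle x y)]; push_cast; ring
  rw [e]
  refine ⟨h1.1.sub h2.1, ?_⟩
  rw [sub_apply, h3, Pi.sub_apply, h1.2, h2.2, integral_sub h1.1 h2.1]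

theorem HasCompactL1Operator.sub {r r' : X → X → ℝ≥0} (h : HasCompactL1Operator μ ν L r)
    (h' : HasCompactL1Operator μ ν L r') (hle : ∀ x y, r' x y ≤ r x y) :
    HasCompactL1Operator μ ν L (fun x y => r x y - r' x y) := by
  obtain ⟨R, hR, hc⟩ := h
  obtain ⟨R', hR', hc'⟩ := h'
  exact ⟨R - R', hR.sub hR' hle, hc.sub hc'⟩

theorem HasCompactL1Operator.add {r r' : X → X → ℝ≥0} (h : HasCompactL1Operator μ ν L r)
    (h' : HasCompactL1Operator μ ν L r') :
    HasCompactL1Operator μ ν L (fun x y => r x y + r' x y) := by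
  obtain ⟨R, hR, hc⟩ := h
  obtain ⟨R', hR', hc'⟩ := h'
  refine ⟨R + R', fun f => ?_, hc.add hc'⟩
  filter_upwards [hR f, hR' f, Lp.coeFn_add (R f) (R' f)] with x h1 h2 h3
  have e : (fun y => ((r x y + r' x y : ℝ≥0) : ℂ) * val μ f y) =
      fun y => (r x y : ℂ) * val μ f y + (r' x y : ℂ) * val μ f y := by
    funext y; push_cast; ring
  rw [e]
  refine ⟨h1.1.add h2.1, ?_⟩
  rw [add_apply, h3, Pi.add_apply, h1.2, h2.2, integral_add h1.1 h2.1]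

theorem HasCompactL1Operator.const_mul {r : X → X → ℝ≥0} (h : HasCompactL1Operator μ ν L r)
    (c : ℝ≥0) : HasCompactL1Operator μ ν L (fun x y => c * r x y) := by
  obtain ⟨R, hR, hc⟩ := h
  refine ⟨(c : ℂ) • R, fun f => ?_, hc.smul (c : ℂ)⟩
  filter_upwards [hR f, Lp.coeFn_smul (c : ℂ) (R f)] with x h1 h3
  have e : (fun y => ((c * r x y : ℝ≥0) : ℂ) * val μ f y) =
      fun y => (c : ℂ) * ((r x y : ℂ) * val μ f y) := by
    funext y; push_cast; ring
  rw [e]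
  refine ⟨h1.1.const_mul _, ?_⟩
  rw [smul_apply, h3, Pi.smul_apply, h1.2, integral_const_mul, smul_eq_mul]

variable (μ ν L) in
theorem hasCompactL1Operator_zero : HasCompactL1Operator μ ν L (fun _ _ => 0) := by
  refine ⟨0, fun f => ?_, isCompactOperator_zero⟩
  filter_upwards [Lp.coeFn_zero ℂ 1 ν] with x hx
  simp only [NNReal.coe_zero, Complex.ofReal_zero, zero_mul, integral_zero]
  exact ⟨integrable_zero _ _ _, hx⟩

theorem HasCompactL1Operator.sum {ι : Type*} (s : Finset ι) {r : ι → X → X → ℝ≥0}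
    (h : ∀ i, HasCompactL1Operator μ ν L (r i)) :
    HasCompactL1Operator μ ν L (fun x y => ∑ i ∈ s, r i x y) := by
  classical
  induction s using Finset.induction with
  | empty => simpa using hasCompactL1Operator_zero μ ν L
  | insert i s hi ih =>
    simp only [Finset.sum_insert hi]
    exact (h i).add ih

/-- Compactness passes to increasing limits of kernels: by order continuity of the dual norm, the
operators converge in norm. -/
theorem hasCompactL1Operator_of_tendsto [SigmaFinite μ] [SigmaFinite ν]
    (hL : DualHasOrderContinuousNorm μ L)
    {r : X → X → ℝ≥0} {C : ℝ≥0} (hr : HasL1Bound μ ν L r C) {s : ℕ → X → X → ℝ≥0}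
    (hsm : ∀ n, Measurable (Function.uncurry (s n))) (hmono : ∀ x y, Monotone fun n => s n x y)
    (hlim : ∀ x y, Tendsto (fun n => s n x y) atTop (𝓝 (r x y)))
    (hs : ∀ n, HasCompactL1Operator μ ν L (s n)) : HasCompactL1Operator μ ν L r := by
  have hle : ∀ n x y, s n x y ≤ r x y := fun n x y => (hmono x y).ge_of_tendsto (hlim x y) n
  have hdm : ∀ n, Measurable (Function.uncurry fun x y => r x y - s n x y) := fun n =>
    hr.1.sub (hsm n)
  have hd : ∀ n, HasL1Bound μ ν L (fun x y => r x y - s n x y) C := fun n =>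
    hr.mono (hdm n) fun x y => tsub_le_self
  obtain ⟨R, hR⟩ := hr.exists_isL1Kernel
  choose S hS hSc using hs
  have hdy : ∀ n y, Measurable fun x => ((r x y - s n x y : ℝ≥0) : ℝ≥0∞) := fun n y =>
    ((hdm n).comp measurable_prodMk_right).coe_nnreal_ennreal
  obtain ⟨c, hc, hcb⟩ := hL.exists_bound
    (v := fun n y => ∫⁻ x, ((r x y - s n x y : ℝ≥0) : ℝ≥0∞) ∂ν) (C := C)
    (fun n => (hdm n).coe_nnreal_ennreal.lintegral_prod_left'.aemeasurable)
    (ae_of_all _ fun y a b hab => lintegral_mono fun x => 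
      ENNReal.coe_le_coe.2 (tsub_le_tsub_left (hmono x y hab) _))
    (ae_of_all _ fun y hy => by
      have h1 := tendsto_lintegral_of_dominated_convergence (μ := ν)
        (F := fun n x => ((r x y - s n x y : ℝ≥0) : ℝ≥0∞)) (f := fun _ => 0)
        (fun x => ((r x y - s 0 x y : ℝ≥0) : ℝ≥0∞)) (fun n => hdy n y)
        (fun n => ae_of_all _ fun x => 
          ENNReal.coe_le_coe.2 (tsub_le_tsub_left (hmono x y (Nat.zero_le n)) _)) hy
        (ae_of_all _ fun x => by
          have h2 := (tendsto_const_nhds (x := r x y)).sub (hlim x y)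
          rw [tsub_self] at h2
          exact ENNReal.tendsto_coe.2 h2)
      simpa using h1) (hd 0).2
  refine ⟨R, hR, isCompactOperator_of_tendsto (F := S) (l := atTop) ?_
    (Eventually.of_forall hSc)⟩
  rw [tendsto_iff_norm_sub_tendsto_zero]
  refine squeeze_zero (fun n => norm_nonneg _) (fun n => ?_) (NNReal.tendsto_coe.2 hc)
  rw [norm_sub_rev]
  exact (hR.sub (hS n) (hle n)).norm_le ⟨hdm n, hcb n⟩

/-- A kernel of rank one. -/
theorem hasCompactL1Operator_mul {a b : X → ℝ≥0} (ha : Measurable a) (hb : Measurable b)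
    (ha1 : ∫⁻ x, a x ∂ν ≠ ∞) {C : ℝ≥0} (hbL : ∀ f : L, ∫⁻ y, b y * ‖val μ f y‖ₑ ∂μ ≤ C * ‖f‖ₑ) :
    HasCompactL1Operator μ ν L (fun x y => a x * b y) := by
  obtain ⟨φ, hφ⟩ := exists_dual_of_lintegral_mul_le hb.coe_nnreal_ennreal.aemeasurable hbL
  have hai : Integrable (fun x => (a x : ℂ)) ν := by
    refine ⟨(Complex.measurable_ofReal.comp ha.coe_nnreal_real).aestronglyMeasurable, ?_⟩
    rw [hasFiniteIntegral_iff_enorm]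
    simpa only [enorm_coe_nnreal_complex] using ha1.lt_top
  refine ⟨φ.smulRight (hai.toL1 _), fun f => ?_, ?_⟩
  · filter_upwards [hai.coeFn_toL1, Lp.coeFn_smul (φ f) (hai.toL1 _)] with x h1 h2
    have e : (fun y => ((a x * b y : ℝ≥0) : ℂ) * val μ f y) =
        fun y => (a x : ℂ) * (((b y : ℝ≥0∞).toReal : ℂ) * val μ f y) := by
      funext y
      rw [ENNReal.coe_toReal]; push_cast; ring
    rw [e]
    refine ⟨(hφ f).1.const_mul _, ?_⟩
    rw [ContinuousLinearMap.smulRight_apply, h2, Pi.smul_apply, h1, integral_const_mul,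
      (hφ f).2, smul_eq_mul, mul_comm]
  · have h1 : IsCompactOperator φ := isCompactOperator_of_locallyCompactSpace_dom φ
    have h2 := h1.clm_comp (ContinuousLinearMap.toSpanSingleton ℂ (hai.toL1 _))
    exact h2

theorem hasL1Bound_mul {a b : X → ℝ≥0} (ha : Measurable a) (hb : Measurable b)
    (ha1 : ∫⁻ x, a x ∂ν ≠ ∞) (hbL : ∀ f : L, ∫⁻ y, b y * ‖val μ f y‖ₑ ∂μ ≤ ‖f‖ₑ) :
    HasL1Bound μ ν L (fun x y => a x * b y) (∫⁻ x, a x ∂ν).toNNReal := by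
  refine ⟨(ha.comp measurable_fst).mul (hb.comp measurable_snd), fun f => ?_⟩
  rw [ENNReal.coe_toNNReal ha1]
  have e : ∀ y, (∫⁻ x, ((a x * b y : ℝ≥0) : ℝ≥0∞) ∂ν) * ‖val μ f y‖ₑ =
      (∫⁻ x, a x ∂ν) * (b y * ‖val μ f y‖ₑ) := fun y => by
    push_cast
    rw [lintegral_mul_const _ ha.coe_nnreal_ennreal, mul_assoc]
  simp only [e]
  rw [lintegral_const_mul' _ _ ha1]
  gcongr
  exact hbL f

theorem hasCompactL1Operator_indicator [SigmaFinite μ] [SigmaFinite ν]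
    (hL : DualHasOrderContinuousNorm μ L)
    {a b : X → ℝ≥0} (ha : Measurable a) (hb : Measurable b)
    (ha1 : ∫⁻ x, a x ∂ν ≠ ∞) (hbL : ∀ f : L, ∫⁻ y, b y * ‖val μ f y‖ₑ ∂μ ≤ ‖f‖ₑ)
    {A : Set (X × X)} (hA : MeasurableSet A) :
    HasCompactL1Operator μ ν L
      (fun x y => A.indicator (fun p => a p.1 * b p.2) (x, y)) := by
  have hm : Measurable fun p : X × X => a p.1 * b p.2 :=
    (ha.comp measurable_fst).mul (hb.comp measurable_snd)
  have hfull : HasCompactL1Operator μ ν L (fun x y => a x * b y) :=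
    hasCompactL1Operator_mul (C := 1) ha hb ha1 (by simpa using hbL)
  have hbd : ∀ A : Set (X × X), MeasurableSet A → HasL1Bound μ ν L
      (fun x y => A.indicator (fun p => a p.1 * b p.2) (x, y)) (∫⁻ x, a x ∂ν).toNNReal :=
    fun A hA => (hasL1Bound_mul ha hb ha1 hbL).mono (hm.indicator hA) fun x y =>
      Set.indicator_le_self' (fun _ _ => zero_le) _
  induction A, hA using MeasurableSpace.induction_on_inter generateFrom_prod.symm
    isPiSystem_prod with
  | empty => simpa using hasCompactL1Operator_zero μ ν L
  | basic t ht =>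
    obtain ⟨E, hE, F, hF, rfl⟩ := ht
    have h1 := hasCompactL1Operator_mul (μ := μ) (ν := ν) (L := L) (C := 1) (ha.indicator hE)
      (hb.indicator hF) (ne_top_of_le_ne_top ha1 (lintegral_mono fun x => by
        gcongr
        exact Set.indicator_le_self' (fun _ _ => zero_le) _)) (fun f => by
        rw [ENNReal.coe_one, one_mul]
        refine (lintegral_mono fun y => ?_).trans (hbL f)
        gcongr
        exact Set.indicator_le_self' (fun _ _ => zero_le) _)
    convert h1 using 3 with x y
    by_cases hx : x ∈ E <;> by_cases hy : y ∈ F <;> simp [hx, hy]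
  | compl t ht ih =>
    convert hfull.sub ih (fun x y =>
      Set.indicator_le_self' (fun _ _ => zero_le) (x, y)) using 3 with x y
    by_cases h : (x, y) ∈ t <;> simp [h]
  | iUnion f hd hf ih =>
    refine hasCompactL1Operator_of_tendsto hL (hbd _ (MeasurableSet.iUnion hf))
      (s := fun n x y => ∑ i ∈ Finset.range n, (f i).indicator (fun p => a p.1 * b p.2) (x, y))
      (fun n => Finset.measurable_fun_sum _ fun i _ => hm.indicator (hf i)) (fun x y => ?_)
      (fun x y => ?_) (fun n => HasCompactL1Operator.sum _ ih)
    · intro n k hnk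
      exact Finset.sum_le_sum_of_subset (Finset.range_mono hnk)
    · refine tendsto_const_nhds.congr' ?_
      by_cases h : (x, y) ∈ ⋃ i, f i
      · obtain ⟨i, hi⟩ := Set.mem_iUnion.1 h
        filter_upwards [eventually_gt_atTop i] with n hn
        rw [Set.indicator_of_mem h, Finset.sum_eq_single i, Set.indicator_of_mem hi]
        · intro j _ hj
          exact Set.indicator_of_notMem (fun h' => Set.disjoint_left.1 (hd hj) h' hi) _
        · intro h'
          exact absurd (Finset.mem_range.2 hn) h'
      · refine Eventually.of_forall fun n => ?_
        rw [Set.indicator_of_notMem h]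
        refine (Finset.sum_eq_zero fun i _ => ?_).symm
        exact Set.indicator_of_notMem (fun h' => h (Set.mem_iUnion.2 ⟨i, h'⟩)) _

/-- If the dual norm is order continuous, then every nonnegative kernel that maps `L` boundedly into
`L¹(ν)` does so compactly. This reduces to kernels `(x, y) ↦ a x * b y` on measurable rectangles,
which have rank one, by a monotone class argument. -/
theorem HasL1Bound.hasCompactL1Operator [SigmaFinite μ] [SigmaFinite ν]
    (hL : DualHasOrderContinuousNorm μ L)
    {b : X → ℝ≥0} (hb : Measurable b) (hb0 : ∀ y, 0 < b y)
    (hbL : ∀ f : L, ∫⁻ y, b y * ‖val μ f y‖ₑ ∂μ ≤ ‖f‖ₑ)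
    {r : X → X → ℝ≥0} {C : ℝ≥0} (hr : HasL1Bound μ ν L r C) : HasCompactL1Operator μ ν L r := by
  obtain ⟨a, ha0, ha, ha1⟩ := exists_pos_lintegral_lt_of_sigmaFinite ν one_ne_zero
  have ha1' : ∫⁻ x, a x ∂ν ≠ ∞ := (ha1.trans ENNReal.one_lt_top).ne
  have hm : Measurable fun p : X × X => a p.1 * b p.2 :=
    (ha.comp measurable_fst).mul (hb.comp measurable_snd)
  have key : ∀ q : X × X → ℝ≥0∞, Measurable q → (∀ p, q p ≠ ∞) →
      HasL1Bound μ ν L (fun x y => a x * b y * (q (x, y)).toNNReal) C →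
      HasCompactL1Operator μ ν L (fun x y => a x * b y * (q (x, y)).toNNReal) := by
    intro q hq
    refine Measurable.ennreal_induction (motive := fun q => (∀ p, q p ≠ ∞) →
      HasL1Bound μ ν L (fun x y => a x * b y * (q (x, y)).toNNReal) C →
      HasCompactL1Operator μ ν L (fun x y => a x * b y * (q (x, y)).toNNReal)) ?_ ?_ ?_ hq
    · intro c s hs _ _
      -- for `c = ∞` both sides vanish, because `(∞ : ℝ≥0∞).toNNReal = 0`
      convert (hasCompactL1Operator_indicator hL ha hb ha1' hbL hs).const_mul c.toNNReal
        using 3 with x y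
      by_cases h : (x, y) ∈ s <;> simp [h, mul_comm]
    · intro f g _ hf hg ihf ihg htop hbd
      have hft : ∀ p, f p ≠ ∞ := fun p => ne_top_of_le_ne_top (htop p) le_self_add
      have hgt : ∀ p, g p ≠ ∞ := fun p => ne_top_of_le_ne_top (htop p) le_add_self
      have e : ∀ p, ((f + g) p).toNNReal = (f p).toNNReal + (g p).toNNReal := fun p =>
        ENNReal.toNNReal_add (hft p) (hgt p)
      have h1 := ihf hft (hbd.mono (hm.mul hf.ennreal_toNNReal) fun x y => by
        rw [e]; gcongr; exact le_self_add)
      have h2 := ihg hgt (hbd.mono (hm.mul hg.ennreal_toNNReal) fun x y => by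
        rw [e]; gcongr; exact le_add_self)
      convert h1.add h2 using 3 with x y
      rw [e, mul_add]
    · intro f hf hmono ih htop hbd
      have hle : ∀ n p, f n p ≤ ⨆ n, f n p := fun n p => le_iSup (fun n => f n p) n
      have hnt : ∀ n p, f n p ≠ ∞ := fun n p => ne_top_of_le_ne_top (htop p) (hle n p)
      refine hasCompactL1Operator_of_tendsto hL hbd
        (s := fun n x y => a x * b y * (f n (x, y)).toNNReal)
        (fun n => hm.mul (hf n).ennreal_toNNReal) (fun x y n k hnk => ?_) (fun x y => ?_)
        (fun n => ih n (hnt n) (hbd.mono (hm.mul (hf n).ennreal_toNNReal) fun x y => ?_))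
      · exact mul_le_mul_right (ENNReal.toNNReal_mono (hnt k _) (hmono hnk _)) _
      · refine Tendsto.const_mul _ ?_
        exact (ENNReal.tendsto_toNNReal (htop _)).comp
          (tendsto_atTop_iSup fun n k hnk => hmono hnk (x, y))
      · exact mul_le_mul_right (ENNReal.toNNReal_mono (htop _) (hle n _)) _
  have e : ∀ x y, a x * b y * ((r x y / (a x * b y) : ℝ≥0) : ℝ≥0∞).toNNReal = r x y :=
    fun x y => by
      rw [ENNReal.toNNReal_coe, mul_div_cancel₀]
      exact (mul_pos (ha0 x) (hb0 y)).ne'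
  have h1 := key (fun p => ((r p.1 p.2 / (a p.1 * b p.2) : ℝ≥0) : ℝ≥0∞))
    (hr.1.div hm).coe_nnreal_ennreal (fun p => ENNReal.coe_ne_top) (by simpa only [e] using hr)
  simpa only [e] using h1

end L1Kernels

/-! ### The Hausdorff measure of non-compactness -/

section Truncation

variable {X : Type*} [MeasurableSpace X] {μ : Measure X} [SigmaFinite μ] {L : Type*}
  [NormedAddCommGroup L] [NormedSpace ℂ L] [CompleteSpace L] [BanachFunctionSpace μ L]

/-- A positive kernel operator is compact as an operator into a weighted `L¹`-space whose
norm is weaker than that of `L`, hence it maps the unit ball to a set in which every sequence has a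
subsequence that converges almost everywhere. -/
theorem IsNNKernel.exists_subseq_tendsto_ae (hL : HasOrderContinuousNorm μ L)
    (hL' : DualHasOrderContinuousNorm μ L) {T : L →L[ℂ] L} {t : X → X → ℝ≥0}
    (hT : IsNNKernel μ T t) {f : ℕ → L} (hf : ∀ n, ‖f n‖ ≤ 1) :
    ∃ (ns : ℕ → ℕ) (g : X → ℂ), StrictMono ns ∧ AEStronglyMeasurable g μ ∧
      ∀ᵐ x ∂μ, Tendsto (fun n => val μ (T (f (ns n))) x) atTop (𝓝 (g x)) := by
  obtain ⟨w, hwm, hw0, hw⟩ := hL.exists_pos_density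
  let ν : Measure X := μ.withDensity fun x => (w x : ℝ≥0∞)
  have : SigmaFinite ν := SigmaFinite.withDensity w
  have hνμ : ν ≪ μ := withDensity_absolutelyContinuous _ _
  have hμν : μ ≪ ν := withDensity_absolutelyContinuous' hwm.coe_nnreal_ennreal.aemeasurable
    (ae_of_all _ fun x => by simpa using (hw0 x).ne')
  have hb : HasL1Bound μ ν L t ‖T‖₊ := by
    refine ⟨hT.1, fun h => ?_⟩
    have h1 : ∀ᵐ x ∂ν, ∫⁻ y, t x y * ‖val μ h y‖ₑ ∂μ = ‖val μ (T (modulus μ h)) x‖ₑ :=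
      ((hT.enorm_val_modulus h).mono fun x hx => hx.symm).filter_mono hνμ.ae_le
    rw [← lintegral_lintegral_kernel hT.1, lintegral_congr_ae h1,
      lintegral_withDensity_eq_lintegral_mul₀ hwm.coe_nnreal_ennreal.aemeasurable
        (aestronglyMeasurable_val μ _).enorm]
    refine (hw _).trans ?_
    calc ‖T (modulus μ h)‖ₑ ≤ ‖T‖ₑ * ‖modulus μ h‖ₑ := T.le_opENorm _
      _ = _ := by rw [← ofReal_norm (modulus μ h), norm_modulus, ofReal_norm]; rfl
  obtain ⟨R, hR, hRc⟩ := hb.hasCompactL1Operator hL' hwm hw0 hw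
  have hcomp := hRc.isCompact_closure_image_closedBall 1
  obtain ⟨G, -, φ, hφ, hlim⟩ := hcomp.tendsto_subseq (x := fun n => R (f n)) fun n =>
    subset_closure ⟨f n, by simpa using hf n, rfl⟩
  obtain ⟨ψ, hψ, hψlim⟩ := (tendstoInMeasure_of_tendsto_Lp hlim).exists_seq_tendsto_ae
  refine ⟨φ ∘ ψ, G, hφ.comp hψ, (Lp.aestronglyMeasurable G).mono_ac hμν, ?_⟩
  have h1 : ∀ᵐ x ∂ν, ∀ n, R (f n) x = val μ (T (f n)) x := ae_all_iff.2 fun n => by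
    filter_upwards [hR (f n), (hT.2 (f n)).filter_mono hνμ.ae_le] with x h1 h2
    rw [h1.2, h2.2]
  refine Eventually.filter_mono hμν.ae_le ?_
  filter_upwards [h1, hψlim] with x h2 h3
  simpa only [Function.comp_apply, h2] using h3

/-- Truncated at a fixed `u`, the image of the unit ball under a positive kernel operator is totally
bounded: on an order interval, convergence almost everywhere is convergence in norm. -/
theorem IsNNKernel.totallyBounded_trunc (hL : HasOrderContinuousNorm μ L)
    (hL' : DualHasOrderContinuousNorm μ L) {T : L →L[ℂ] L} {t : X → X → ℝ≥0}
    (hT : IsNNKernel μ T t) (u : L) :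
    TotallyBounded {g : L | ∃ f : L, ‖f‖ ≤ 1 ∧
      val μ g =ᵐ[μ] fun x => trunc ‖val μ u x‖ (val μ (T f) x)} := by
  set K : Set L := {g : L | ∃ f : L, ‖f‖ ≤ 1 ∧
      val μ g =ᵐ[μ] fun x => trunc ‖val μ u x‖ (val μ (T f) x)} with hK
  rw [Metric.totallyBounded_iff]
  intro ε hε
  by_contra hcon
  push Not at hcon
  obtain ⟨g, hgK, hgd⟩ := exists_seq_of_forall_finset_exists (fun g : L => g ∈ K)
    (fun g h => ε ≤ dist h g) fun s _ => by
      obtain ⟨h, hhK, hh⟩ := Set.not_subset.1 (hcon s s.finite_toSet)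
      refine ⟨h, hhK, fun x hx => ?_⟩
      by_contra hlt
      exact hh (Set.mem_biUnion (Finset.mem_coe.2 hx) (Metric.mem_ball.2 (not_le.1 hlt)))
  have hgK' : ∀ n, ∃ f : L, ‖f‖ ≤ 1 ∧
      val μ (g n) =ᵐ[μ] fun x => trunc ‖val μ u x‖ (val μ (T f) x) := fun n => hgK n
  choose f hf hgf using hgK'
  obtain ⟨ns, G, hns, hGm, hlim⟩ := hT.exists_subseq_tendsto_ae hL hL' hf
  have hall : ∀ᵐ x ∂μ, Tendsto (fun n => val μ (g (ns n)) x) atTop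
      (𝓝 (trunc ‖val μ u x‖ (G x))) := by
    filter_upwards [ae_all_iff.2 hgf, hlim] with x h1 h2
    simp only [h1]
    exact ((continuous_trunc (norm_nonneg _)).tendsto _).comp h2
  have htm : AEStronglyMeasurable (fun x => trunc ‖val μ u x‖ (G x)) μ :=
    aestronglyMeasurable_of_tendsto_ae atTop (fun n => aestronglyMeasurable_val μ _) hall
  obtain ⟨h, hh⟩ := exists_val_ae_eq μ u htm
    (ae_of_all _ fun x => norm_trunc_le_radius (norm_nonneg _) _)
  have hconv : Tendsto (fun n => g (ns n)) atTop (𝓝 h) := by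
    refine hL.tendsto u (fun n => ?_) ?_
    · filter_upwards [hgf (ns n)] with x hx
      rw [hx]
      exact norm_trunc_le_radius (norm_nonneg _) _
    · filter_upwards [hall, hh] with x h1 h2
      rw [h2]
      exact h1
  obtain ⟨N, hN⟩ := Metric.cauchySeq_iff.1 hconv.cauchySeq ε hε
  exact absurd (hN (N + 1) (Nat.le_succ N) N le_rfl)
    (not_lt.2 (hgd (ns N) (ns (N + 1)) (hns (Nat.lt_succ_self N))))

end Truncation

section MeasureOfNoncompactness

variable {E : Type*} [NormedAddCommGroup E] [NormedSpace ℂ E]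

/-- The image of the unit ball under `T` has a finite `δ`-net. -/
def HasFiniteNet (T : E →L[ℂ] E) (δ : ℝ) : Prop :=
  ∃ M : Set E, M.Finite ∧ ∀ f : E, ‖f‖ ≤ 1 → ∃ m ∈ M, ‖T f - m‖ ≤ δ

theorem hausdorffMNC_eq (T : E →L[ℂ] E) :
    hausdorffMNC T = sInf {δ : ℝ | 0 < δ ∧ HasFiniteNet T δ} := by
  unfold hausdorffMNC HasFiniteNet
  congr 1
  ext δ
  refine and_congr_right fun hδ => exists_congr fun M => and_congr_right fun _ => ?_
  rw [smul_closedBall _ _ zero_le_one, smul_zero, Real.norm_of_nonneg hδ.le, mul_one]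
  constructor
  · intro h f hf
    obtain ⟨m, hm, b, hb, hmb⟩ := h ⟨f, by simpa using hf, rfl⟩
    refine ⟨m, hm, ?_⟩
    have hmb' : m + b = T f := hmb
    rw [← hmb', add_sub_cancel_left]
    simpa using hb
  · rintro h _ ⟨f, hf, rfl⟩
    obtain ⟨m, hm, hb⟩ := h f (by simpa using hf)
    exact ⟨m, hm, T f - m, by simpa using hb, by simp⟩

theorem hausdorffMNC_nonneg (T : E →L[ℂ] E) : 0 ≤ hausdorffMNC T :=
  Real.sInf_nonneg fun _ hδ => hδ.1.le

theorem hausdorffMNC_le {T : E →L[ℂ] E} {δ : ℝ} (hδ : 0 < δ) (h : HasFiniteNet T δ) :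
    hausdorffMNC T ≤ δ := by
  rw [hausdorffMNC_eq]
  exact csInf_le ⟨0, fun _ hδ => hδ.1.le⟩ ⟨hδ, h⟩

theorem exists_hasFiniteNet_lt (T : E →L[ℂ] E) {ε : ℝ} (hε : 0 < ε) :
    ∃ δ, 0 < δ ∧ HasFiniteNet T δ ∧ δ < hausdorffMNC T + ε := by
  have hne : {δ : ℝ | 0 < δ ∧ HasFiniteNet T δ}.Nonempty := by
    refine ⟨‖T‖ + 1, by positivity, {0}, Set.finite_singleton 0, fun f hf => ⟨0, rfl, ?_⟩⟩
    rw [sub_zero]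
    refine (T.le_opNorm f).trans ?_
    nlinarith [norm_nonneg T]
  obtain ⟨δ, ⟨hδ, h⟩, hlt⟩ := exists_lt_of_csInf_lt hne
    (lt_add_of_pos_right (sInf {δ : ℝ | 0 < δ ∧ HasFiniteNet T δ}) hε)
  refine ⟨δ, hδ, h, ?_⟩
  rwa [hausdorffMNC_eq]

theorem hausdorffMNC_add_le (A B : E →L[ℂ] E) :
    hausdorffMNC (A + B) ≤ hausdorffMNC A + hausdorffMNC B := by
  refine le_of_forall_pos_le_add fun ε hε => ?_
  obtain ⟨δ, hδ, ⟨M, hM, h⟩, hlt⟩ := exists_hasFiniteNet_lt A (half_pos hε)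
  obtain ⟨δ', hδ', ⟨M', hM', h'⟩, hlt'⟩ := exists_hasFiniteNet_lt B (half_pos hε)
  refine (hausdorffMNC_le (add_pos hδ hδ') ⟨M + M', hM.add hM', fun f hf => ?_⟩).trans
    (by linarith)
  obtain ⟨m, hm, hmd⟩ := h f hf
  obtain ⟨m', hm', hmd'⟩ := h' f hf
  refine ⟨m + m', Set.add_mem_add hm hm', ?_⟩
  rw [add_apply, add_sub_add_comm]
  exact (norm_add_le _ _).trans (add_le_add hmd hmd')

theorem hausdorffMNC_smul_le (c : ℝ≥0) (A : E →L[ℂ] E) :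
    hausdorffMNC ((c : ℂ) • A) ≤ c * hausdorffMNC A := by
  have key : ∀ ε > 0, hausdorffMNC ((c : ℂ) • A) ≤ c * (hausdorffMNC A + ε) + ε := by
    intro ε hε
    obtain ⟨δ, hδ, ⟨M, hM, h⟩, hlt⟩ := exists_hasFiniteNet_lt A hε
    refine (hausdorffMNC_le (δ := c * δ + ε) (by positivity)
      ⟨(c : ℂ) • M, hM.smul_set, fun f hf => ?_⟩).trans (by gcongr)
    obtain ⟨m, hm, hmd⟩ := h f hf
    refine ⟨(c : ℂ) • m, Set.smul_mem_smul_set hm, ?_⟩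
    rw [smul_apply, ← smul_sub, norm_smul, Complex.norm_real, NNReal.norm_eq]
    exact (mul_le_mul_of_nonneg_left hmd c.2).trans (le_add_of_nonneg_right hε.le)
  have hlim : Tendsto (fun ε : ℝ => c * (hausdorffMNC A + ε) + ε) (𝓝[>] 0)
      (𝓝 (c * (hausdorffMNC A + 0) + 0)) :=
    tendsto_nhdsWithin_of_tendsto_nhds
      (((tendsto_const_nhds.add tendsto_id).const_mul _).add tendsto_id)
  simp only [add_zero] at hlim
  exact ge_of_tendsto hlim (by filter_upwards [self_mem_nhdsWithin] with ε h using key ε h)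

variable {X : Type*} [MeasurableSpace X] {μ : Measure X} [SigmaFinite μ] {L : Type*}
  [NormedAddCommGroup L] [NormedSpace ℂ L] [CompleteSpace L] [BanachFunctionSpace μ L]

/-- If `M` is a finite `δ`-net for `S` and `u = ∑_{m ∈ M} |m|`, then `|T f| ≤ S |f| ≤ u + g` with
`‖g‖ ≤ δ`, so that `T f` is within `δ` of its truncation at `u`; and these truncations form a
totally bounded set. -/
theorem KernelLE.hausdorffMNC_le (hL : HasOrderContinuousNorm μ L)
    (hL' : DualHasOrderContinuousNorm μ L) {T S : L →L[ℂ] L} (h : KernelLE μ T S) :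
    hausdorffMNC T ≤ hausdorffMNC S := by
  refine le_of_forall_pos_le_add fun ε hε => ?_
  obtain ⟨δ, hδ, ⟨M, hM, hnet⟩, hlt⟩ := exists_hasFiniteNet_lt S (half_pos hε)
  lift M to Finset L using hM
  let u : L := ∑ m ∈ M, modulus μ m
  have hu : ∀ᵐ x ∂μ, ∀ m ∈ M, ‖val μ m x‖ ≤ ‖val μ u x‖ := by
    have h1 : ∀ᵐ x ∂μ, ∀ m ∈ M, val μ (modulus μ m) x = (‖val μ m x‖ : ℂ) :=
      (ae_ball_iff M.countable_toSet).2 fun m _ => val_modulus μ m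
    filter_upwards [h1, val_sum μ M (modulus μ)] with x h2 h3 m hm
    rw [h3, Finset.sum_congr rfl h2, ← Complex.ofReal_sum, Complex.norm_real,
      Real.norm_of_nonneg (Finset.sum_nonneg fun _ _ => norm_nonneg _)]
    exact Finset.single_le_sum (f := fun m => ‖val μ m x‖) (fun _ _ => norm_nonneg _) hm
  have hle := h.norm_val_le
  obtain ⟨t, -, ht, -⟩ := h
  obtain ⟨N, hN, hNK⟩ := Metric.totallyBounded_iff.1
    (ht.totallyBounded_trunc hL hL' u) (ε / 2) (half_pos hε)
  refine (_root_.hausdorffMNC_le (δ := δ + ε / 2) (by positivity)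
    ⟨N, hN, fun f hf => ?_⟩).trans (by linarith)
  obtain ⟨g, hg⟩ := exists_val_eq_trunc μ u (T f)
  obtain ⟨n, hn, hgn⟩ := Set.mem_iUnion₂.1 (hNK ⟨f, hf, hg⟩)
  obtain ⟨m, hm, hmd⟩ := hnet (modulus μ f) (by rwa [norm_modulus])
  refine ⟨n, hn, ?_⟩
  have h1 : ‖T f - g‖ ≤ ‖S (modulus μ f) - m‖ := by
    refine norm_le_of_val_ae_le μ ?_
    filter_upwards [hu, hg, val_sub μ (T f) g, val_sub μ (S (modulus μ f)) m,
      hle f] with x h2 h3 h4 h5 h6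
    rw [h4, h5, h3]
    refine norm_sub_trunc_le (norm_nonneg _) ?_
    have h7 := norm_le_norm_add_norm_sub' (val μ (S (modulus μ f)) x) (val μ m x)
    exact h6.trans (h7.trans (add_le_add (h2 m hm) le_rfl))
  calc ‖T f - n‖ = ‖(T f - g) + (g - n)‖ := by rw [sub_add_sub_cancel]
    _ ≤ ‖T f - g‖ + ‖g - n‖ := norm_add_le _ _
    _ ≤ δ + ε / 2 := add_le_add (h1.trans hmd) (by
        rw [← dist_eq_norm]
        exact (Metric.mem_ball.1 hgn).le)

theorem isMonotoneSeminorm_hausdorffMNC (hL : HasOrderContinuousNorm μ L)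
    (hL' : DualHasOrderContinuousNorm μ L) :
    IsMonotoneSeminorm μ (hausdorffMNC : (L →L[ℂ] L) → ℝ) where
  nonneg A := hausdorffMNC_nonneg A
  add_le A B := hausdorffMNC_add_le A B
  smul_le c A := hausdorffMNC_smul_le c A
  mono _ _ h := h.hausdorffMNC_le hL hL'

end MeasureOfNoncompactness

theorem corollary3p1 {X : Type*} [MeasurableSpace X] (μ : Measure X) [SigmaFinite μ]
    {k m : ℕ} (hk : 1 ≤ k) (α : Fin m → ℝ) (hα : ∀ j, 0 < α j) (hsum : ∑ j, α j = 1) :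
    (∀ (L : Type*) [NormedAddCommGroup L] [NormedSpace ℂ L] [CompleteSpace L]
        [BanachFunctionSpace μ L] (Ψ : Fin k → Fin m → Set (L →L[ℂ] L)),
        (∀ i j, Bornology.IsBounded (Ψ i j)) →
        (∀ i j, ∀ A ∈ Ψ i j, IsPositiveKernelOperator μ A) →
        (ProductInequalities μ α Ψ (fun A => ‖A‖) ∧ SumInequalities μ α Ψ (fun A => ‖A‖)) ∧
        (HasOrderContinuousNorm μ L → DualHasOrderContinuousNorm μ L →
          ProductInequalities μ α Ψ hausdorffMNC ∧ SumInequalities μ α Ψ hausdorffMNC)) ∧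
    (∀ Ψ : Fin k → Fin m → Set (Lp ℂ 2 μ →L[ℂ] Lp ℂ 2 μ),
        (∀ i j, Bornology.IsBounded (Ψ i j)) →
        (∀ i j, ∀ A ∈ Ψ i j, IsPositiveKernelOperator μ A) →
        ProductInequalities μ α Ψ numericalRadius ∧ SumInequalities μ α Ψ numericalRadius) := by
  refine ⟨fun L _ _ _ _ Ψ _ _ => ⟨⟨?_, ?_⟩, fun hL hL' => ⟨?_, ?_⟩⟩, fun Ψ _ _ => ⟨?_, ?_⟩⟩
  · exact isMonotoneSeminorm_norm.productInequalities hα hsum hk Ψ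
  · exact isMonotoneSeminorm_norm.sumInequalities hα hsum Ψ
  · exact (isMonotoneSeminorm_hausdorffMNC hL hL').productInequalities hα hsum hk Ψ
  · exact (isMonotoneSeminorm_hausdorffMNC hL hL').sumInequalities hα hsum Ψ
  · exact isMonotoneSeminorm_numericalRadius.productInequalities hα hsum hk Ψ
  · exact isMonotoneSeminorm_numericalRadius.sumInequalities hα hsum Ψ
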